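/- Let $\Bbbk$ be a field, let $n_1,\dots,n_r\ge 0$ be integers, and let $S=\Bbbk[x_{i,j}\mid 1\le i\le r,\ 0\le j\le n_i]$ be the Cox ring of $\mathbb{P}^{\vec n}=\mathbb{P}^{n_1}\times\cdots\times\mathbb{P}^{n_r}$ over $\Bbbk$, with the $\mathbb{Z}^r$-grading $\deg x_{i,j}=\mathbf e_i$ and irrelevant ideal $B=\bigcap_{i=1}^r\langle x_{i,0},\dots,x_{i,n_i}\rangle$. For an $S$-module $M$ let $\Gamma_B(M)=\{m\in M\mid B^km=0\text{ for some }k\}$. Let $\Delta$ be a simplicial complex with at least one non-empty face, whose vertices lie in $X=\{x_{i,j}\mid 1\le i\le r,\ 0\le j\le n_i\}$ (not every element of $X$ has to be a vertex of $\Delta$), and let $I_\Delta\subseteq S$ be its Stanley–Reisner ideal, generated by the squarefree monomials $\prod_{x\in\tau}x$ with $\tau\subseteq X$, $\tau\notin\Delta$. The complex $\Delta$ is pure if all its facets have the same dimension, and balanced if every facet contains, for each $i$, exactly one of the vertices $x_{i,0},\dots,x_{i,n_i}$. A virtual resolution of $S/I$, for an ideal $I\subseteq S$, is a $\mathbb{Z}^r$-graded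 complex $F_\bullet=[F_0\leftarrow F_1\leftarrow\cdots\leftarrow F_p\leftarrow 0]$ of finitely generated graded free $S$-modules such that $\sqrt{\operatorname{ann} H_i(F_\bullet)}\supseteq B$ for all $i>0$ and $H_0(F_\bullet)/\Gamma_B(H_0(F_\bullet))\cong (S/I)/\Gamma_B(S/I)$ as graded $S$-modules; its length is $p$ if $F_p\ne 0$. The complex $\Delta$ is virtually Cohen–Macaulay over $\Bbbk$ if it is $B$-saturated, that is, $I_\Delta:B^\infty=I_\Delta$, and $S/I_\Delta$ has a virtual resolution of length $\operatorname{codim} I_\Delta:=n_1+\cdots+n_r-\dim V(I_\Delta)$, where $V(I_\Delta)\subseteq\mathbb{P}^{\vec n}$ is the closed subset (of the scheme $\mathbb{P}^{\vec n}$) defined by $I_\Delta$. **Theorem.** If $\Delta$ is pure and balanced, then $\Delta$ is virtually Cohen–Macaulay. -/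

import Mathlib

open scoped BigOperators

noncomputable section

namespace VirtualCM

/-! ### The Cox ring of a product of projective spaces -/

/-- The variables `x_{i,j}`, `i` a component and `0 ≤ j ≤ n_i`. -/
abbrev Vertex {r : ℕ} (n : Fin r → ℕ) : Type := Σ i : Fin r, Fin (n i + 1)

/-- The Cox ring `S = k[x_{i,j}]` of `ℙ^{n_1} × ⋯ × ℙ^{n_r}`. -/
abbrev Cox (k : Type*) [Field k] {r : ℕ} (n : Fin r → ℕ) : Type _ := MvPolynomial (Vertex n) k

/-- The weight of the variable `x_{i,j}`, which is the standard basis vector `e_i`. -/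
def multideg {r : ℕ} (n : Fin r → ℕ) (v : Vertex n) : Fin r → ℤ := Pi.single v.1 1

/-- `S_δ`, the polynomials that are homogeneous of multidegree `δ`. -/
def coxGrading (k : Type*) [Field k] {r : ℕ} (n : Fin r → ℕ) (δ : Fin r → ℤ) :
    Submodule k (Cox k n) :=
  MvPolynomial.weightedHomogeneousSubmodule k (multideg n) δ

instance (k : Type*) [Field k] {r : ℕ} (n : Fin r → ℕ) : GradedAlgebra (coxGrading k n) :=
  MvPolynomial.weightedGradedAlgebra k (multideg n)

/-- The irrelevant ideal `B = ⋂ᵢ ⟨x_{i,0}, …, x_{i,n_i}⟩`. -/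
def irrelevantIdeal (k : Type*) [Field k] {r : ℕ} (n : Fin r → ℕ) : Ideal (Cox k n) :=
  ⨅ i : Fin r, Ideal.span (Set.range fun j : Fin (n i + 1) =>
    (MvPolynomial.X (⟨i, j⟩ : Vertex n) : Cox k n))

/-- The saturation `I : J^∞ = ⋃ₘ (I : Jᵐ)`; the union is increasing, hence equal to the
supremum. -/
def saturation {R : Type*} [CommRing R] (I J : Ideal R) : Ideal R :=
  ⨆ m : ℕ, I.colon ((J ^ m : Ideal R) : Set R)

/-- `Γ_J(M)`, the elements of `M` that are annihilated by some power of `J`. -/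
def torsionPart {R : Type*} [CommRing R] (J : Ideal R) (M : Type*) [AddCommGroup M]
    [Module R M] : Submodule R M where
  carrier := {x | ∃ m : ℕ, ∀ b ∈ J ^ m, b • x = 0}
  zero_mem' := ⟨0, fun b _ => smul_zero b⟩
  add_mem' := by
    rintro x y ⟨a, ha⟩ ⟨b, hb⟩
    refine ⟨a + b, fun c hc => ?_⟩
    rw [smul_add, ha c (Ideal.pow_le_pow_right (Nat.le_add_right a b) hc),
      hb c (Ideal.pow_le_pow_right (Nat.le_add_left b a) hc), add_zero]
  smul_mem' := by
    rintro c x ⟨a, ha⟩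
    exact ⟨a, fun b hb => by rw [smul_comm, ha b hb, smul_zero]⟩

/-! ### The variety of an ideal and its codimension -/

/-- The variety `V(I)` in `ℙ^{n_1} × ⋯ × ℙ^{n_r}`. The points of the scheme
`ℙ^{n_1} × ⋯ × ℙ^{n_r}` over `k` are the multihomogeneous primes of the Cox ring that do not
contain the irrelevant ideal; `V(I)` consists of those that contain `I`, and it carries the
Zariski topology (as a subspace of the spectrum of the Cox ring). -/
def variety {k : Type*} [Field k] {r : ℕ} (n : Fin r → ℕ) (I : Ideal (Cox k n)) :
    Set (PrimeSpectrum (Cox k n)) :=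
  {p | p.asIdeal.IsHomogeneous (coxGrading k n) ∧ ¬ irrelevantIdeal k n ≤ p.asIdeal ∧
    I ≤ p.asIdeal}

/-- `c = |n| - dim V(I)`, where `|n| = n_1 + ⋯ + n_r`; in particular `V(I)` is non-empty, the
dimension of the empty space being `⊥`. -/
def IsCodim {k : Type*} [Field k] {r : ℕ} (n : Fin r → ℕ) (I : Ideal (Cox k n)) (c : ℕ) : Prop :=
  (c : WithBot ℕ∞) + topologicalKrullDim (variety n I) = ((∑ i, n i : ℕ) : WithBot ℕ∞)

/-! ### Graded free complexes and virtual resolutions -/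

/-- The homology `ker g / (im f ∩ ker g)` at the middle term of `M → N → P`; the intersection is
`im f` when `g ∘ f = 0`. -/
abbrev homologyAt {R M N P : Type*} [CommRing R] [AddCommGroup M] [AddCommGroup N]
    [AddCommGroup P] [Module R M] [Module R N] [Module R P] (f : M →ₗ[R] N) (g : N →ₗ[R] P) :
    Type _ :=
  LinearMap.ker g ⧸ (LinearMap.range f).submoduleOf (LinearMap.ker g)

/-- A `ℤ^r`-graded complex `F_0 ← F_1 ← F_2 ← ⋯` of finitely generated graded free modules
over the Cox ring: `F_i` is the direct sum of `S(-deg i a)` over `a` in the finite set `idx i`. -/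
structure GradedFreeComplex (k : Type*) [Field k] {r : ℕ} (n : Fin r → ℕ) where
  /-- the index set of a homogeneous basis of `F_i` -/
  idx : ℕ → Type
  finite_idx : ∀ i, Finite (idx i)
  /-- the degrees of the basis elements -/
  deg : ∀ i, idx i → Fin r → ℤ
  /-- the differential `F_{i+1} → F_i` -/
  d : ∀ i, (idx (i + 1) →₀ Cox k n) →ₗ[Cox k n] (idx i →₀ Cox k n)
  d_comp_d : ∀ i, d i ∘ₗ d (i + 1) = 0
  /-- the differentials preserve the degree -/
  d_homogeneous : ∀ (i : ℕ) (δ : Fin r → ℤ) (x : idx (i + 1) →₀ Cox k n),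
    (∀ a, x a ∈ coxGrading k n (δ - deg (i + 1) a)) →
      ∀ b, d i x b ∈ coxGrading k n (δ - deg i b)

namespace GradedFreeComplex

variable {k : Type*} [Field k] {r : ℕ} {n : Fin r → ℕ}

/-- The free module `F_i`. -/
abbrev term (F : GradedFreeComplex k n) (i : ℕ) : Type _ := F.idx i →₀ Cox k n

/-- `x ∈ F_i` is homogeneous of degree `δ`. -/
def IsHomogeneousOfDegree (F : GradedFreeComplex k n) (i : ℕ) (δ : Fin r → ℤ)
    (x : F.term i) : Prop :=
  ∀ a, x a ∈ coxGrading k n (δ - F.deg i a)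

/-- `F` has length `c`, that is, it is `F_0 ← ⋯ ← F_c ← 0` with `F_c ≠ 0`. -/
def HasLength (F : GradedFreeComplex k n) (c : ℕ) : Prop :=
  Nonempty (F.idx c) ∧ ∀ i, c < i → IsEmpty (F.idx i)

/-- The homology `H_0 = F_0 / im d`. -/
abbrev H₀ (F : GradedFreeComplex k n) : Type _ := F.term 0 ⧸ LinearMap.range (F.d 0)

/-- The homology `H_{i+1} = ker (F_{i+1} → F_i) / im (F_{i+2} → F_{i+1})`. -/
abbrev Hsucc (F : GradedFreeComplex k n) (i : ℕ) : Type _ := homologyAt (F.d (i + 1)) (F.d i)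

/-- `F` is a virtual resolution of `S/I`: the irrelevant ideal `B` is contained in
`√(ann H_i(F))` for `i > 0`, and `H_0(F) / Γ_B(H_0(F))` is isomorphic to `(S/I) / Γ_B(S/I)` as a
graded module. The classes of the homogeneous elements of degree `δ` make up the graded piece of
degree `δ` of either side. -/
def IsVirtualResolution (F : GradedFreeComplex k n) (I : Ideal (Cox k n)) : Prop :=
  (∀ i, irrelevantIdeal k n ≤ (Module.annihilator (Cox k n) (F.Hsucc i)).radical) ∧
  ∃ e : (F.H₀ ⧸ torsionPart (irrelevantIdeal k n) F.H₀) ≃ₗ[Cox k n]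
      ((Cox k n ⧸ I) ⧸ torsionPart (irrelevantIdeal k n) (Cox k n ⧸ I)),
    ∀ δ : Fin r → ℤ,
      e '' {y | ∃ x : F.term 0, F.IsHomogeneousOfDegree 0 δ x ∧
        y = Submodule.Quotient.mk (Submodule.Quotient.mk x)} =
      {z | ∃ f ∈ coxGrading k n δ, z = Submodule.Quotient.mk (Ideal.Quotient.mk I f)}

end GradedFreeComplex

/-! ### Simplicial complexes on the vertex set of a product of projective spaces -/

variable {r : ℕ} {n : Fin r → ℕ}

/-- The Stanley–Reisner ideal, generated by the squarefree monomials of the non-faces. (The faces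
of a `PreAbstractSimplicialComplex` are by convention non-empty, the empty set counts as a
face here. Not every vertex has to be a face.) -/
def stanleyReisnerIdeal (k : Type*) [Field k] (Δ : PreAbstractSimplicialComplex (Vertex n)) :
    Ideal (Cox k n) :=
  Ideal.span {f | ∃ τ : Finset (Vertex n), τ.Nonempty ∧ τ ∉ Δ ∧
    f = ∏ v ∈ τ, (MvPolynomial.X v : Cox k n)}

/-- A facet is an inclusion-maximal face. -/
def IsFacet (Δ : PreAbstractSimplicialComplex (Vertex n)) (σ : Finset (Vertex n)) : Prop :=
  Maximal (fun τ => τ ∈ Δ) σ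

/-- All facets have the same dimension. -/
def IsPure (Δ : PreAbstractSimplicialComplex (Vertex n)) : Prop :=
  ∀ σ τ, IsFacet Δ σ → IsFacet Δ τ → σ.card = τ.card

/-- Every facet has exactly one vertex in each component. -/
def IsBalanced (Δ : PreAbstractSimplicialComplex (Vertex n)) : Prop :=
  ∀ σ, IsFacet Δ σ → ∀ i : Fin r, ∃! v : Vertex n, v ∈ σ ∧ v.1 = i

/-- `Δ` is `B`-saturated, that is, `I_Δ : B^∞ = I_Δ`. -/
def IsBSaturated (k : Type*) [Field k] (Δ : PreAbstractSimplicialComplex (Vertex n)) : Prop :=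
  saturation (stanleyReisnerIdeal k Δ) (irrelevantIdeal k n) = stanleyReisnerIdeal k Δ

/-- `Δ` is virtually Cohen–Macaulay over `k`: it is `B`-saturated, and `k[Δ] = S/I_Δ` has a virtual
resolution of length `codim I_Δ`. -/
def IsVirtuallyCohenMacaulay (k : Type*) [Field k]
    (Δ : PreAbstractSimplicialComplex (Vertex n)) : Prop :=
  IsBSaturated k Δ ∧
  ∃ (c : ℕ) (F : GradedFreeComplex k n), IsCodim n (stanleyReisnerIdeal k Δ) c ∧
    F.HasLength c ∧ F.IsVirtualResolution (stanleyReisnerIdeal k Δ)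

end VirtualCM

end

noncomputable section

namespace VirtualCM

universe u

/-! ### Graded modules and graded free resolutions -/

section Resolutions

variable {k : Type u} [Field k] {r : ℕ} {n : Fin r → ℕ}

/-! Write |n| for the sum of the `n i`. A point of `V(I_Δ)` is a homogeneous prime p that contains
I_Δ but not B. It contains all variables outside some facet σ; then no variable of σ lies in p, for
otherwise p would contain all variables of a component and hence B. The vertices of σ have linearly
independent multidegrees, so a homogeneous element modulo the variables outside σ is a scalar times
one monomial in the variables of σ, and p is generated by the variables outside σ. Thus `V(I_Δ)` is
a finite discrete set, with one point per facet, and the codimension is |n|.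

The virtual resolution is an honest free resolution of S/(I_Δ ∩ B). Since I_Δ · B lies in I_Δ ∩ B
and I_Δ is saturated, the B-torsion of S/(I_Δ ∩ B) is I_Δ/(I_Δ ∩ B), so passing from I_Δ to I_Δ ∩ B
is invisible to the definition. What remains is that S/(I_Δ ∩ B) has projective dimension at most
|n|.

The ideal I_Δ ∩ B belongs to the complex of those vertex sets that lie in a facet or miss a
component. For a complex D and a set R, multiplication by x^R gives an exact sequence relating S/I_D
to its link {A | A ∪ R ∈ D} and its deletion {A ∈ D | R ⊄ A}; by the horseshoe lemma, a bound for
both is a bound for D (`FaceRes.of_link_of_deletion`). A facet σ is a transversal, so each proper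
subset of σ misses a component: deleting σ removes σ alone, and its link is the full simplex on σ,
resolved by a Koszul complex on |n| variables. This reduces to a single facet
(`faceRes_generatedOrMissing`). There the vertices outside the facet are deleted one at a time
(`faceRes_subset_or_missing`), the links being complexes of sets that miss a component
(`faceRes_missing`), until only a simplex is left. -/

/-- A family of subgroups of a module over the Cox ring is compatible with multiplication by
homogeneous polynomials. -/
def IsGradedFamily (k : Type u) [Field k] {r : ℕ} (n : Fin r → ℕ) {M : Type u}
    [AddCommGroup M] [Module (Cox k n) M]
    (g : (Fin r → ℤ) → AddSubgroup M) : Prop :=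
  ∀ ⦃d e : Fin r → ℤ⦄ ⦃f : Cox k n⦄ ⦃x : M⦄, f ∈ coxGrading k n d → x ∈ g e → f • x ∈ g (d + e)

/-- The homogeneous elements of degree `δ` of the graded free module with basis elements of
degrees `deg`. -/
def freeGr {ι : Type} (deg : ι → Fin r → ℤ) (δ : Fin r → ℤ) : AddSubgroup (ι →₀ Cox k n) where
  carrier := {x | ∀ a, x a ∈ coxGrading k n (δ - deg a)}
  zero_mem' := fun _ => Submodule.zero_mem _
  add_mem' := fun hx hy a => Submodule.add_mem _ (hx a) (hy a)
  neg_mem' := fun hx a => Submodule.neg_mem _ (hx a)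

theorem mem_freeGr {ι : Type} {deg : ι → Fin r → ℤ} {δ : Fin r → ℤ} {x : ι →₀ Cox k n} :
    x ∈ freeGr deg δ ↔ ∀ a, x a ∈ coxGrading k n (δ - deg a) := Iff.rfl

theorem mul_mem_coxGrading {d e : Fin r → ℤ} {f g : Cox k n} (hf : f ∈ coxGrading k n d)
    (hg : g ∈ coxGrading k n e) : f * g ∈ coxGrading k n (d + e) :=
  MvPolynomial.IsWeightedHomogeneous.mul hf hg

theorem one_mem_coxGrading : (1 : Cox k n) ∈ coxGrading k n 0 :=
  MvPolynomial.isWeightedHomogeneous_one k _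

theorem isGradedFamily_freeGr {ι : Type} (deg : ι → Fin r → ℤ) :
    IsGradedFamily k n (freeGr (k := k) (n := n) deg) := by
  intro d e f x hf hx a
  have h := mul_mem_coxGrading hf (hx a)
  rwa [← add_sub_assoc] at h

theorem single_mem_freeGr {ι : Type} (deg : ι → Fin r → ℤ) (a : ι) :
    Finsupp.single a (1 : Cox k n) ∈ freeGr deg (deg a) := by
  classical
  intro b
  rw [Finsupp.single_apply]
  split_ifs with h
  · subst h
    rw [sub_self]
    exact one_mem_coxGrading
  · exact Submodule.zero_mem _

section Family

variable {M : Type u} [AddCommGroup M] [Module (Cox k n) M] {g : (Fin r → ℤ) → AddSubgroup M}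

/-- A homogeneous element is a combination of basis elements whose coefficients have the
complementary degrees, so a map out of a graded free module preserves degrees as soon as it does so
on the basis. -/
theorem map_mem_of_mem_freeGr (hg : IsGradedFamily k n g) {ι : Type} {deg : ι → Fin r → ℤ}
    (L : (ι →₀ Cox k n) →ₗ[Cox k n] M) (hL : ∀ a, L (Finsupp.single a 1) ∈ g (deg a))
    {δ : Fin r → ℤ} {x : ι →₀ Cox k n} (hx : x ∈ freeGr deg δ) : L x ∈ g δ := by
  rw [← x.sum_single, Finsupp.sum, map_sum]
  refine AddSubgroup.sum_mem _ fun a _ => ?_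
  have h := hg (hx a) (hL a)
  rwa [← map_smul, Finsupp.smul_single, smul_eq_mul, mul_one, sub_add_cancel] at h

/-- The grading induced on a submodule. -/
def subGr (K : Submodule (Cox k n) M) (g : (Fin r → ℤ) → AddSubgroup M) (δ : Fin r → ℤ) :
    AddSubgroup K :=
  (g δ).comap K.subtype.toAddMonoidHom

theorem mem_subGr {K : Submodule (Cox k n) M} {δ : Fin r → ℤ} {x : K} :
    x ∈ subGr K g δ ↔ (x : M) ∈ g δ := Iff.rfl

theorem IsGradedFamily.subGr (hg : IsGradedFamily k n g) (K : Submodule (Cox k n) M) :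
    IsGradedFamily k n (subGr K g) :=
  fun _ _ _ _ hf hx => hg hf hx

end Family

/-- A linear map that maps the graded pieces onto the graded pieces. -/
structure IsGradedSurjection {M N : Type u} [AddCommGroup M] [AddCommGroup N]
    [Module (Cox k n) M] [Module (Cox k n) N] (g : (Fin r → ℤ) → AddSubgroup M)
    (h : (Fin r → ℤ) → AddSubgroup N) (p : M →ₗ[Cox k n] N) : Prop where
  surjective : Function.Surjective p
  map_mem : ∀ {δ x}, x ∈ g δ → p x ∈ h δ
  exists_lift : ∀ {δ y}, y ∈ h δ → ∃ x ∈ g δ, p x = y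

/-- A short exact sequence of graded modules. -/
structure IsGradedExact {M' M M'' : Type u} [AddCommGroup M'] [AddCommGroup M] [AddCommGroup M'']
    [Module (Cox k n) M'] [Module (Cox k n) M] [Module (Cox k n) M'']
    (g' : (Fin r → ℤ) → AddSubgroup M') (g : (Fin r → ℤ) → AddSubgroup M)
    (g'' : (Fin r → ℤ) → AddSubgroup M'') (i : M' →ₗ[Cox k n] M) (p : M →ₗ[Cox k n] M'') :
    Prop where
  injective : Function.Injective i
  ker_eq : LinearMap.ker p = LinearMap.range i
  mem_iff : ∀ {δ x}, i x ∈ g δ ↔ x ∈ g' δ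
  surj : IsGradedSurjection g g'' p

/-- The graded module `M` has a graded free resolution by finitely generated modules in which only
the first `c` terms are non-zero. -/
def HasRes (k : Type u) [Field k] {r : ℕ} (n : Fin r → ℕ) : ℕ → ∀ (M : Type u) [AddCommGroup M] [Module (Cox k n) M],
    ((Fin r → ℤ) → AddSubgroup M) → Prop
  | 0, M, _, _, _ => Subsingleton M
  | c + 1, M, _, _, g => ∃ (ι : Type) (_ : Finite ι) (deg : ι → Fin r → ℤ)
      (ε : (ι →₀ Cox k n) →ₗ[Cox k n] M), IsGradedSurjection (freeGr deg) g ε ∧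
        HasRes k n c (LinearMap.ker ε) (subGr (LinearMap.ker ε) (freeGr deg))

variable {M' M M'' : Type u} [AddCommGroup M'] [AddCommGroup M] [AddCommGroup M'']
  [Module (Cox k n) M'] [Module (Cox k n) M] [Module (Cox k n) M'']
  {g' : (Fin r → ℤ) → AddSubgroup M'} {g : (Fin r → ℤ) → AddSubgroup M}
  {g'' : (Fin r → ℤ) → AddSubgroup M''}

theorem HasRes.of_subsingleton (c : ℕ) : ∀ (M : Type u) [AddCommGroup M] [Module (Cox k n) M]
    (g : (Fin r → ℤ) → AddSubgroup M), Subsingleton M → HasRes k n c M g := by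
  induction c with
  | zero => intro M _ _ g h; exact h
  | succ c ih =>
    intro M _ _ g h
    refine ⟨Empty, inferInstance, Empty.elim, 0,
      ⟨fun y => ⟨0, Subsingleton.elim _ _⟩, fun _ => ?_, fun _ => ⟨0, zero_mem _,
        Subsingleton.elim _ _⟩⟩, ih _ _ inferInstance⟩
    rw [LinearMap.zero_apply]
    exact zero_mem _

theorem HasRes.succ {c : ℕ} : ∀ {M : Type u} [AddCommGroup M] [Module (Cox k n) M]
    {g : (Fin r → ℤ) → AddSubgroup M}, HasRes k n c M g → HasRes k n (c + 1) M g := by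
  induction c with
  | zero => intro M _ _ g h; exact HasRes.of_subsingleton 1 M g h
  | succ c ih =>
    rintro M _ _ g ⟨ι, hι, deg, ε, hε, h⟩
    exact ⟨ι, hι, deg, ε, hε, ih h⟩

theorem HasRes.mono {c c' : ℕ} (h : HasRes k n c M g) (hc : c ≤ c') : HasRes k n c' M g := by
  induction hc with
  | refl => exact h
  | step _ ih => exact ih.succ

theorem hasRes_one_free {ι : Type} [Finite ι] (deg : ι → Fin r → ℤ) :
    HasRes k n 1 (ι →₀ Cox k n) (freeGr deg) := by
  refine ⟨ι, inferInstance, deg, LinearMap.id,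
    ⟨fun y => ⟨y, rfl⟩, fun h => h, fun {_ y} h => ⟨y, h, rfl⟩⟩, ?_⟩
  change Subsingleton _
  rw [LinearMap.ker_id]
  infer_instance

/-- The kernels of compatible surjections onto the terms of a short exact sequence form a short
exact sequence. -/
theorem IsGradedExact.ker {F' F F'' : Type u} [AddCommGroup F'] [AddCommGroup F]
    [AddCommGroup F''] [Module (Cox k n) F'] [Module (Cox k n) F] [Module (Cox k n) F'']
    {f' : (Fin r → ℤ) → AddSubgroup F'} {f : (Fin r → ℤ) → AddSubgroup F}
    {f'' : (Fin r → ℤ) → AddSubgroup F''} {i : M' →ₗ[Cox k n] M} {p : M →ₗ[Cox k n] M''}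
    {j : F' →ₗ[Cox k n] F} {q : F →ₗ[Cox k n] F''}
    (hM : IsGradedExact g' g g'' i p) (hF : IsGradedExact f' f f'' j q)
    {ε' : F' →ₗ[Cox k n] M'} {ε : F →ₗ[Cox k n] M} {ε'' : F'' →ₗ[Cox k n] M''}
    (hε' : IsGradedSurjection f' g' ε') (hε : ∀ {δ x}, x ∈ f δ → ε x ∈ g δ)
    (hj : ∀ x, ε (j x) = i (ε' x)) (hq : ∀ x, ε'' (q x) = p (ε x)) :
    IsGradedExact (subGr (LinearMap.ker ε') f') (subGr (LinearMap.ker ε) f)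
      (subGr (LinearMap.ker ε'') f'')
      (j.restrict (p := LinearMap.ker ε') (q := LinearMap.ker ε) fun x hx => by
        rw [LinearMap.mem_ker] at hx ⊢; rw [hj, hx, map_zero])
      (q.restrict (p := LinearMap.ker ε) (q := LinearMap.ker ε'') fun x hx => by
        rw [LinearMap.mem_ker] at hx ⊢; rw [hq, hx, map_zero]) := by
  have hpi : ∀ x, p (i x) = 0 := fun x => by
    have : i x ∈ LinearMap.ker p := hM.ker_eq ▸ LinearMap.mem_range_self i x
    exact this
  have hqj : ∀ x, q (j x) = 0 := fun x => by
    have : j x ∈ LinearMap.ker q := hF.ker_eq ▸ LinearMap.mem_range_self j x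
    exact this
  have key : ∀ x : F, ε'' (q x) = 0 → ∃ y, i y = ε x := fun x hx => by
    rw [hq] at hx
    have : ε x ∈ LinearMap.range i := hM.ker_eq ▸ hx
    exact this
  refine ⟨?_, ?_, ?_, ?_, ?_, ?_⟩
  · intro x y hxy
    have := congrArg Subtype.val hxy
    exact Subtype.ext (hF.injective this)
  · ext ⟨x, hx⟩
    constructor
    · intro h
      have h1 : q x = 0 := congrArg Subtype.val h
      have h2 : x ∈ LinearMap.range j := hF.ker_eq ▸ h1
      obtain ⟨y, rfl⟩ := h2
      refine ⟨⟨y, ?_⟩, rfl⟩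
      rw [LinearMap.mem_ker, hj] at hx
      exact hM.injective (hx.trans (map_zero i).symm)
    · rintro ⟨y, hy⟩
      have h1 : j y = x := congrArg Subtype.val hy
      apply Subtype.ext
      change q x = 0
      rw [← h1, hqj]
  · intro δ x
    exact hF.mem_iff
  · rintro ⟨y, hy⟩
    obtain ⟨x, rfl⟩ := hF.surj.surjective y
    obtain ⟨m, hm⟩ := key x hy
    obtain ⟨z, rfl⟩ := hε'.surjective m
    refine ⟨⟨x - j z, ?_⟩, Subtype.ext ?_⟩
    · rw [LinearMap.mem_ker, map_sub, hj, hm, sub_self]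
    · change q (x - j z) = q x
      rw [map_sub, hqj, sub_zero]
  · intro δ x hx
    exact hF.surj.map_mem hx
  · rintro δ ⟨y, hy⟩ hyδ
    obtain ⟨x, hxδ, hxy⟩ := hF.surj.exists_lift (mem_subGr.1 hyδ)
    change q x = y at hxy
    subst hxy
    obtain ⟨m, hm⟩ := key x hy
    -- The correction `j z` has to be homogeneous of degree δ as well; this is possible because `i`
    -- reflects degrees.
    have hmδ : m ∈ g' δ := hM.mem_iff.1 (by rw [hm]; exact hε hxδ)
    obtain ⟨z, hzδ, rfl⟩ := hε'.exists_lift hmδ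
    refine ⟨⟨x - j z, ?_⟩, ?_, Subtype.ext ?_⟩
    · rw [LinearMap.mem_ker, map_sub, hj, hm, sub_self]
    · exact sub_mem hxδ (hF.mem_iff.2 hzδ)
    · change q (x - j z) = q x
      rw [map_sub, hqj, sub_zero]

/-- The split short exact sequence of free modules belonging to a disjoint union of bases. -/
theorem isGradedExact_freeGr_sum {ι κ : Type} (deg : ι → Fin r → ℤ) (deg' : κ → Fin r → ℤ) :
    IsGradedExact (freeGr (k := k) (n := n) deg) (freeGr (Sum.elim deg deg')) (freeGr deg')
      ((Finsupp.sumFinsuppLEquivProdFinsupp (Cox k n)).symm.toLinearMap ∘ₗ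
        LinearMap.inl (Cox k n) (ι →₀ Cox k n) (κ →₀ Cox k n))
      (LinearMap.snd (Cox k n) (ι →₀ Cox k n) (κ →₀ Cox k n) ∘ₗ
        (Finsupp.sumFinsuppLEquivProdFinsupp (Cox k n)).toLinearMap) := by
  refine ⟨?_, ?_, ?_, ?_, ?_, ?_⟩
  · rw [LinearMap.coe_comp]
    exact (LinearEquiv.injective _).comp LinearMap.inl_injective
  · ext x
    constructor
    · intro hx
      refine ⟨(Finsupp.sumFinsuppLEquivProdFinsupp (Cox k n) x).1, ?_⟩
      rw [LinearMap.comp_apply, LinearEquiv.coe_coe, LinearEquiv.symm_apply_eq]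
      exact Prod.ext rfl (Eq.symm hx)
    · rintro ⟨y, rfl⟩
      simp
  · intro δ x
    constructor
    · intro h a
      exact h (Sum.inl a)
    · rintro h (a | a)
      · exact h a
      · exact Submodule.zero_mem _
  · rw [LinearMap.coe_comp]
    exact LinearMap.snd_surjective.comp (LinearEquiv.surjective _)
  · intro δ x h a
    exact h (Sum.inr a)
  · intro δ y h
    refine ⟨(Finsupp.sumFinsuppLEquivProdFinsupp (Cox k n)).symm (0, y), ?_, ?_⟩
    · rintro (a | a)
      · exact Submodule.zero_mem _
      · exact h a
    · simp

/-- The horseshoe lemma. -/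
theorem HasRes.of_exact {c : ℕ} : ∀ {M' M M'' : Type u} [AddCommGroup M'] [AddCommGroup M]
    [AddCommGroup M''] [Module (Cox k n) M'] [Module (Cox k n) M] [Module (Cox k n) M'']
    {g' : (Fin r → ℤ) → AddSubgroup M'} {g : (Fin r → ℤ) → AddSubgroup M}
    {g'' : (Fin r → ℤ) → AddSubgroup M''} {i : M' →ₗ[Cox k n] M} {p : M →ₗ[Cox k n] M''},
    IsGradedFamily k n g → IsGradedExact g' g g'' i p → HasRes k n c M' g' → HasRes k n c M'' g'' →
    HasRes k n c M g := by
  induction c with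
  | zero =>
    intro M' M M'' _ _ _ _ _ _ g' g g'' i p _ h h' h''
    change Subsingleton _ at h' h'' ⊢
    refine subsingleton_of_forall_eq 0 fun x => ?_
    have : x ∈ LinearMap.range i := h.ker_eq ▸ (Subsingleton.elim _ _ : p x = 0)
    obtain ⟨y, rfl⟩ := this
    rw [Subsingleton.elim y 0, map_zero]
  | succ c ih =>
    rintro M' M M'' _ _ _ _ _ _ g' g g'' i p hg h ⟨ι', hι', deg', ε', hε', h'⟩
      ⟨ι, hι, deg, ε'', hε'', h''⟩
    -- The images of the basis of the free cover of `M''` are lifted to homogeneous elements of `M`;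
    -- with the cover of `M'` these lifts give a cover of `M`, and the induction continues with the
    -- kernels.
    have hlift : ∀ a : ι, ∃ m ∈ g (deg a), p m = ε'' (Finsupp.single a 1) := fun a =>
      h.surj.exists_lift (hε''.map_mem (single_mem_freeGr deg a))
    choose ℓ hℓ hpℓ using hlift
    let L : (ι →₀ Cox k n) →ₗ[Cox k n] M := Finsupp.linearCombination (Cox k n) ℓ
    have hL : ∀ a, L (Finsupp.single a 1) = ℓ a := fun a => by
      simp [L, Finsupp.linearCombination_single]
    have hpL : p ∘ₗ L = ε'' := by
      refine Finsupp.lhom_ext' fun a => LinearMap.ext_ring ?_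
      change p (L (Finsupp.single a 1)) = ε'' (Finsupp.single a 1)
      rw [hL, hpℓ]
    let ε : (ι' ⊕ ι →₀ Cox k n) →ₗ[Cox k n] M :=
      (LinearMap.coprod (i ∘ₗ ε') L) ∘ₗ
        (Finsupp.sumFinsuppLEquivProdFinsupp (Cox k n)).toLinearMap
    have hpi : ∀ x, p (i x) = 0 := fun x => by
      have : i x ∈ LinearMap.ker p := h.ker_eq ▸ LinearMap.mem_range_self i x
      exact this
    have hεsymm : ∀ x y, ε ((Finsupp.sumFinsuppLEquivProdFinsupp (Cox k n)).symm (x, y)) =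
        i (ε' x) + L y := fun x y => by simp [ε]
    have hLmem : ∀ {δ x}, x ∈ freeGr deg δ → L x ∈ g δ := fun hx =>
      map_mem_of_mem_freeGr hg L (fun a => by rw [hL]; exact hℓ a) hx
    have hεmem : ∀ {δ x}, x ∈ freeGr (Sum.elim deg' deg) δ → ε x ∈ g δ := fun {δ x} hx => by
      refine add_mem (h.mem_iff.2 (hε'.map_mem (x := (Finsupp.sumFinsuppLEquivProdFinsupp
        (Cox k n) x).1) ?_)) (hLmem (x := (Finsupp.sumFinsuppLEquivProdFinsupp
        (Cox k n) x).2) ?_)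
      · exact fun a => hx (Sum.inl a)
      · exact fun a => hx (Sum.inr a)
    have hex := h.ker (isGradedExact_freeGr_sum deg' deg) (ε := ε) (ε'' := ε'') hε' hεmem
      (fun x => by
        change ε ((Finsupp.sumFinsuppLEquivProdFinsupp (Cox k n)).symm (x, 0)) = _
        rw [hεsymm, map_zero, add_zero])
      (fun x => by
        change ε'' _ = p (i _ + L _)
        rw [map_add, hpi, zero_add, ← hpL]
        rfl)
    refine ⟨ι' ⊕ ι, inferInstance, Sum.elim deg' deg, ε, ⟨?_, hεmem, ?_⟩,
      ih ((isGradedFamily_freeGr _).subGr _) hex h' h''⟩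
    · intro m
      obtain ⟨y, hy⟩ := hε''.surjective (p m)
      have : m - L y ∈ LinearMap.range i := h.ker_eq ▸ (by
        rw [LinearMap.mem_ker, map_sub, ← LinearMap.comp_apply, hpL, hy, sub_self])
      obtain ⟨z, hz⟩ := this
      obtain ⟨x, rfl⟩ := hε'.surjective z
      exact ⟨_, (hεsymm x y).trans (by rw [hz, sub_add_cancel])⟩
    · intro δ m hm
      obtain ⟨y, hyδ, hy⟩ := hε''.exists_lift (h.surj.map_mem hm)
      have : m - L y ∈ LinearMap.range i := h.ker_eq ▸ (by
        rw [LinearMap.mem_ker, map_sub, ← LinearMap.comp_apply, hpL, hy, sub_self])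
      obtain ⟨z, hz⟩ := this
      have hzδ : z ∈ g' δ := h.mem_iff.1 (by rw [hz]; exact sub_mem hm (hLmem hyδ))
      obtain ⟨x, hxδ, rfl⟩ := hε'.exists_lift hzδ
      refine ⟨_, ?_, (hεsymm x y).trans (by rw [hz, sub_add_cancel])⟩
      rintro (a | a)
      · exact hxδ a
      · exact hyδ a

/-- A graded module isomorphic to a graded module with a resolution has a resolution. -/
theorem HasRes.of_equiv {c : ℕ} (hg : IsGradedFamily k n g) (e : M ≃ₗ[Cox k n] M'')
    (he : ∀ δ x, x ∈ g δ ↔ e x ∈ g'' δ) (h : HasRes k n c M'' g'') : HasRes k n c M g := by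
  -- An isomorphism is a short exact sequence whose submodule is zero, so this is a case of the
  -- horseshoe lemma.
  refine HasRes.of_exact (M' := PUnit) (g' := fun _ => ⊤) (i := 0) (p := e.toLinearMap) hg
    ⟨fun _ _ _ => rfl, ?_, ?_, e.surjective, fun hx => (he _ _).1 hx, fun {δ y} hy =>
      ⟨e.symm y, (he _ _).2 (by rwa [e.apply_symm_apply]), e.apply_symm_apply y⟩⟩
    (HasRes.of_subsingleton c _ _ inferInstance) h
  · rw [LinearMap.range_zero, LinearEquiv.ker]
  · intro δ x
    exact ⟨fun _ => AddSubgroup.mem_top x, fun _ => zero_mem _⟩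

/-- The quotient of a short exact sequence has a resolution that is longer by one than that of the
submodule. -/
theorem HasRes.quotient {c : ℕ} {i : M' →ₗ[Cox k n] M} {p : M →ₗ[Cox k n] M''}
    (h : IsGradedExact g' g g'' i p) (h' : HasRes k n c M' g') (hM : HasRes k n (c + 1) M g) :
    HasRes k n (c + 1) M'' g'' := by
  obtain ⟨ι, hι, deg, ε, hε, hK⟩ := hM
  have hpi : ∀ x, p (i x) = 0 := fun x => by
    have : i x ∈ LinearMap.ker p := h.ker_eq ▸ LinearMap.mem_range_self i x
    exact this
  refine ⟨ι, hι, deg, p ∘ₗ ε, ⟨h.surj.surjective.comp hε.surjective,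
    fun hx => h.surj.map_mem (hε.map_mem hx), fun {δ y} hy => ?_⟩, ?_⟩
  · obtain ⟨m, hm, rfl⟩ := h.surj.exists_lift hy
    obtain ⟨x, hx, rfl⟩ := hε.exists_lift hm
    exact ⟨x, hx, rfl⟩
  have hrange : ∀ x ∈ LinearMap.ker (p ∘ₗ ε), ∃ y, i y = ε x := fun x hx => by
    have : ε x ∈ LinearMap.range i := h.ker_eq ▸ hx
    exact this
  let i' := LinearEquiv.ofInjective i h.injective
  let q : LinearMap.ker (p ∘ₗ ε) →ₗ[Cox k n] M' :=
    i'.symm.toLinearMap ∘ₗ (ε.restrict (p := LinearMap.ker (p ∘ₗ ε)) (q := LinearMap.range i)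
      fun x hx => hrange x hx)
  have hq : ∀ x, i (q x) = ε x := fun x =>
    congrArg Subtype.val (i'.apply_symm_apply (ε.restrict (p := LinearMap.ker (p ∘ₗ ε))
      (q := LinearMap.range i) (fun x hx => hrange x hx) x))
  -- The cover `ε` of `M` also covers `M''`. The new kernel is an extension of `M'` by the kernel of
  -- `ε`, and both have resolutions with `c` terms.
  refine HasRes.of_exact (i := Submodule.inclusion (LinearMap.ker_le_ker_comp ε p)) (p := q)
    ((isGradedFamily_freeGr deg).subGr _) ⟨Submodule.inclusion_injective _, ?_, Iff.rfl, ?_, ?_, ?_⟩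
    hK h'
  · ext x
    constructor
    · intro hx
      refine ⟨⟨x, ?_⟩, rfl⟩
      rw [LinearMap.mem_ker, ← hq, LinearMap.mem_ker.1 hx, map_zero]
    · rintro ⟨y, rfl⟩
      refine h.injective ?_
      rw [hq, map_zero]
      exact y.2
  · intro m
    obtain ⟨x, hx⟩ := hε.surjective (i m)
    refine ⟨⟨x, ?_⟩, h.injective ((hq _).trans hx)⟩
    rw [LinearMap.mem_ker, LinearMap.comp_apply, hx, hpi]
  · intro δ x hx
    rw [← h.mem_iff, hq]
    exact hε.map_mem hx
  · intro δ m hm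
    obtain ⟨x, hxδ, hx⟩ := hε.exists_lift (h.mem_iff.2 hm)
    refine ⟨⟨x, ?_⟩, hxδ, h.injective ((hq _).trans hx)⟩
    rw [LinearMap.mem_ker, LinearMap.comp_apply, hx, hpi]

theorem HasRes.congr {c : ℕ} {h : (Fin r → ℤ) → AddSubgroup M} (hM : HasRes k n c M g)
    (e : ∀ δ, g δ = h δ) : HasRes k n c M h := by
  rwa [← funext e]

/-- The shift of a graded module with a resolution has a resolution. -/
theorem HasRes.shift {c : ℕ} (d : Fin r → ℤ) : ∀ {M : Type u} [AddCommGroup M]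
    [Module (Cox k n) M] {g : (Fin r → ℤ) → AddSubgroup M}, HasRes k n c M g →
    HasRes k n c M fun δ => g (δ - d) := by
  induction c with
  | zero => intro M _ _ g h; exact h
  | succ c ih =>
    rintro M _ _ g ⟨ι, hι, deg, ε, hε, h⟩
    have e : ∀ δ, freeGr (k := k) (n := n) (fun a => deg a + d) δ = freeGr deg (δ - d) := by
      intro δ
      ext x
      simp only [mem_freeGr, sub_sub, add_comm d]
    refine ⟨ι, hι, fun a => deg a + d, ε, ⟨hε.surjective, fun hx => ?_, fun hy => ?_⟩,
      (ih h).congr fun δ => ?_⟩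
    · rw [e] at hx
      exact hε.map_mem hx
    · simp only [e]
      exact hε.exists_lift hy
    · rw [subGr, subGr, e]

end Resolutions

/-! ### From iterated kernels to complexes of prescribed length. -/

section Complexes

variable {k : Type u} [Field k] {r : ℕ} {n : Fin r → ℕ}

/-- The complex that is zero in every degree. -/
def GradedFreeComplex.zero (k : Type u) [Field k] {r : ℕ} (n : Fin r → ℕ) :
    GradedFreeComplex k n where
  idx _ := Empty
  finite_idx _ := inferInstance
  deg _ := Empty.elim
  d _ := 0
  d_comp_d _ := LinearMap.comp_zero _
  d_homogeneous _ _ _ _ b := b.elim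

/-- The complex obtained from `G` by adding a free module on the right. -/
def GradedFreeComplex.cons (ι : Type) [Finite ι] (deg : ι → Fin r → ℤ) (G : GradedFreeComplex k n)
    (φ : G.term 0 →ₗ[Cox k n] (ι →₀ Cox k n)) (hφ : φ ∘ₗ G.d 0 = 0)
    (hdeg : ∀ δ x, G.IsHomogeneousOfDegree 0 δ x → φ x ∈ freeGr deg δ) :
    GradedFreeComplex k n where
  idx | 0 => ι
      | i + 1 => G.idx i
  finite_idx | 0 => inferInstance
             | i + 1 => G.finite_idx i
  deg | 0 => deg
      | i + 1 => G.deg i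
  d | 0 => φ
    | i + 1 => G.d i
  d_comp_d | 0 => hφ
           | i + 1 => G.d_comp_d i
  d_homogeneous | 0 => hdeg
                | i + 1 => G.d_homogeneous i

/-- A graded module that has a resolution of length `c` is resolved by a graded free complex whose
term of degree `c` is non-zero. -/
theorem HasRes.exists_complex {c : ℕ} : ∀ {M : Type u} [AddCommGroup M] [Module (Cox k n) M]
    {g : (Fin r → ℤ) → AddSubgroup M}, HasRes k n (c + 1) M g → Nontrivial M →
    ∃ (F : GradedFreeComplex k n) (ε : F.term 0 →ₗ[Cox k n] M), F.HasLength c ∧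
      (∀ i, LinearMap.ker (F.d i) ≤ LinearMap.range (F.d (i + 1))) ∧
      LinearMap.ker ε = LinearMap.range (F.d 0) ∧ IsGradedSurjection (freeGr (F.deg 0)) g ε := by
  induction c with
  | zero =>
    rintro M _ _ g ⟨ι, hι, deg, ε, hε, h⟩ hM
    change Subsingleton _ at h
    have hker : LinearMap.ker ε = ⊥ := (Submodule.subsingleton_iff_eq_bot).1 h
    have hne : Nonempty ι := by
      by_contra hne
      rw [not_nonempty_iff] at hne
      exact not_subsingleton M hε.surjective.subsingleton
    refine ⟨GradedFreeComplex.cons ι deg (GradedFreeComplex.zero k n) 0 (LinearMap.zero_comp _)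
      fun δ x _ => zero_mem _, ε, ⟨hne, ?_⟩, ?_, ?_, hε⟩
    · rintro (_ | i) hi
      · exact absurd hi (lt_irrefl 0)
      · exact inferInstanceAs (IsEmpty Empty)
    · intro i x _
      exact ⟨0, (map_zero _).trans (Subsingleton.elim (α := Empty →₀ Cox k n) _ _)⟩
    · exact hker.trans LinearMap.range_zero.symm
  | succ c ih =>
    rintro M _ _ g ⟨ι, hι, deg, ε, hε, h⟩ hM
    -- a superfluous basis element makes the kernel non-trivial
    let ε₁ : (ι ⊕ Unit →₀ Cox k n) →ₗ[Cox k n] M :=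
      ε ∘ₗ LinearMap.fst (Cox k n) _ _ ∘ₗ
        (Finsupp.sumFinsuppLEquivProdFinsupp (Cox k n)).toLinearMap
    have hε₁ : IsGradedSurjection
        (freeGr (Sum.elim deg (fun _ : Unit => (0 : Fin r → ℤ)))) g ε₁ := by
      refine ⟨fun y => ?_, fun {δ x} hx => ?_, fun {δ y} hy => ?_⟩
      · obtain ⟨x, rfl⟩ := hε.surjective y
        exact ⟨(Finsupp.sumFinsuppLEquivProdFinsupp (Cox k n)).symm (x, 0), by simp [ε₁]⟩
      · exact hε.map_mem (x := (Finsupp.sumFinsuppLEquivProdFinsupp (Cox k n) x).1)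
          fun a => hx (Sum.inl a)
      · obtain ⟨x, hx, rfl⟩ := hε.exists_lift hy
        refine ⟨(Finsupp.sumFinsuppLEquivProdFinsupp (Cox k n)).symm (x, 0), ?_, by simp [ε₁]⟩
        rintro (a | a)
        · exact hx a
        · exact Submodule.zero_mem _
    have hM0 : IsGradedExact g g (fun _ => (⊤ : AddSubgroup PUnit.{u + 1}))
        (LinearMap.id : M →ₗ[Cox k n] M) 0 :=
      ⟨fun _ _ h => h, by rw [LinearMap.ker_zero, LinearMap.range_id], Iff.rfl,
        fun y => ⟨0, rfl⟩, fun _ => AddSubgroup.mem_top _, fun _ => ⟨0, zero_mem _, rfl⟩⟩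
    -- The enlarged kernel is an extension of a free module of rank one by the kernel of `ε`, so it
    -- still has a resolution with `c + 1` terms.
    have hex := hM0.ker (isGradedExact_freeGr_sum deg (fun _ : Unit => (0 : Fin r → ℤ)))
      (ε' := ε) (ε := ε₁) (ε'' := 0) hε hε₁.map_mem (fun x => by simp [ε₁]) (fun x => rfl)
    have hU : HasRes k n (c + 1)
        (LinearMap.ker (0 : (Unit →₀ Cox k n) →ₗ[Cox k n] PUnit.{u + 1}))
        (subGr _ (freeGr (fun _ : Unit => (0 : Fin r → ℤ)))) :=
      ((hasRes_one_free (k := k) (n := n) (fun _ : Unit => (0 : Fin r → ℤ))).of_equiv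
        ((isGradedFamily_freeGr _).subGr _)
        (LinearEquiv.ofTop _ LinearMap.ker_zero) fun _ _ => Iff.rfl).mono (by omega)
    have hres := HasRes.of_exact ((isGradedFamily_freeGr _).subGr _) hex h hU
    have hnt : Nontrivial (LinearMap.ker ε₁) := by
      refine ⟨⟨⟨(Finsupp.sumFinsuppLEquivProdFinsupp (Cox k n)).symm
        (0, Finsupp.single () 1), by simp [ε₁]⟩, 0, fun h0 => ?_⟩⟩
      have h1 := congrArg (fun z : LinearMap.ker ε₁ =>
        (z : ι ⊕ Unit →₀ Cox k n) (Sum.inr ())) h0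
      simp at h1
    obtain ⟨G, η, hlen, hexact, hker, hη⟩ := ih hres hnt
    refine ⟨GradedFreeComplex.cons (ι ⊕ Unit) (Sum.elim deg (fun _ => 0)) G
      ((LinearMap.ker ε₁).subtype ∘ₗ η) ?_ ?_, ε₁, ⟨hlen.1, ?_⟩, ?_, ?_, hε₁⟩
    · ext1 a
      refine LinearMap.ext fun x => ?_
      have : η (G.d 0 (Finsupp.single a x)) = 0 := by
        rw [← LinearMap.mem_ker, hker]
        exact LinearMap.mem_range_self _ _
      simp [this]
    · intro δ x hx
      exact hη.map_mem hx
    · rintro (_ | i) hi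
      · exact absurd hi (Nat.not_lt_zero _)
      · exact hlen.2 i (Nat.lt_of_succ_lt_succ hi)
    · rintro (_ | i)
      · intro x hx
        have hx' : η x = 0 := Subtype.ext hx
        exact hker.le hx'
      · exact hexact i
    · ext x
      constructor
      · intro hx
        obtain ⟨y, hy⟩ := hη.surjective ⟨x, hx⟩
        exact ⟨y, congrArg Subtype.val hy⟩
      · rintro ⟨y, rfl⟩
        exact (η y).2

end Complexes

/-! ### Squarefree monomial ideals -/

section MonomialIdeals

open MvPolynomial

variable (k : Type u) [Field k] {r : ℕ} {n : Fin r → ℕ}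

/-- The ideal spanned by the monomials whose support is not contained in a member of `D`. -/
def faceIdeal (D : Set (Finset (Vertex n))) : Ideal (Cox k n) where
  carrier := {f | ∀ m ∈ f.support, ∀ A ∈ D, ¬ m.support ⊆ A}
  zero_mem' := by simp
  add_mem' := by
    intro f g hf hg m hm
    rcases Finset.mem_union.1 (MvPolynomial.support_add hm) with h | h
    · exact hf m h
    · exact hg m h
  smul_mem' := by
    intro c f hf m hm A hA hmA
    obtain ⟨a, -, b, hb, rfl⟩ := Finset.mem_add.1 (MvPolynomial.support_mul c f hm)
    exact hf b hb A hA ((Finsupp.support_mono le_add_self).trans hmA)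

variable {k}

theorem mem_faceIdeal {D : Set (Finset (Vertex n))} {f : Cox k n} :
    f ∈ faceIdeal k D ↔ ∀ m, coeff m f ≠ 0 → ∀ A ∈ D, ¬ m.support ⊆ A := by
  simp only [← MvPolynomial.mem_support_iff]
  exact Iff.rfl

theorem mem_faceIdeal_of_isLowerSet {D : Set (Finset (Vertex n))} (hD : IsLowerSet D)
    {f : Cox k n} : f ∈ faceIdeal k D ↔ ∀ m, coeff m f ≠ 0 → m.support ∉ D := by
  rw [mem_faceIdeal]
  exact ⟨fun h m hm hmD => h m hm _ hmD subset_rfl, fun h m hm A hA hmA => h m hm (hD hmA hA)⟩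

/-- The grading of `S/I`. -/
def quotGr (I : Ideal (Cox k n)) (δ : Fin r → ℤ) : AddSubgroup (Cox k n ⧸ I) :=
  (coxGrading k n δ).toAddSubgroup.map (Ideal.Quotient.mk I).toAddMonoidHom

theorem mk_mem_quotGr {I : Ideal (Cox k n)} {δ : Fin r → ℤ} {f : Cox k n} :
    Ideal.Quotient.mk I f ∈ quotGr I δ ↔ ∃ h ∈ coxGrading k n δ, f - h ∈ I := by
  constructor
  · rintro ⟨h, hh, he⟩
    exact ⟨h, hh, Ideal.Quotient.eq.1 he.symm⟩
  · rintro ⟨h, hh, he⟩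
    exact ⟨h, hh, (Ideal.Quotient.eq.2 he).symm⟩

theorem isGradedFamily_quotGr (I : Ideal (Cox k n)) : IsGradedFamily k n (quotGr I) := by
  rintro d e f _ hf ⟨h, hh, rfl⟩
  exact ⟨f * h, mul_mem_coxGrading hf hh, rfl⟩

/-- The exponent of the squarefree monomial with support `R`. -/
def expo (R : Finset (Vertex n)) : Vertex n →₀ ℕ := Finsupp.indicator R fun _ _ => 1

theorem support_expo (R : Finset (Vertex n)) : (expo R).support = R := by
  ext v
  simp [expo, Finsupp.indicator_apply]

theorem expo_le_iff {R : Finset (Vertex n)} {m : Vertex n →₀ ℕ} :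
    expo R ≤ m ↔ R ⊆ m.support := by
  constructor
  · intro h
    rw [← support_expo R]
    exact Finsupp.support_mono h
  · intro h v
    by_cases hv : v ∈ R
    · have := h hv
      rw [Finsupp.mem_support_iff] at this
      simp only [expo, Finsupp.indicator_apply, hv, dite_true]
      omega
    · simp [expo, Finsupp.indicator_apply, hv]

theorem support_add_expo (R : Finset (Vertex n)) (m : Vertex n →₀ ℕ) :
    (expo R + m).support = R ∪ m.support := by
  ext v
  rw [Finset.mem_union, ← support_expo R]
  simp only [Finsupp.mem_support_iff, Finsupp.add_apply]
  rw [support_expo]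
  omega

/-- Passing to the link is the colon ideal by x^R: multiplying by x^R enlarges the support of each
monomial by R and never merges two monomials. -/
theorem monomial_expo_mul_mem_iff {D : Set (Finset (Vertex n))} {R : Finset (Vertex n)}
    {f : Cox k n} : monomial (expo R) 1 * f ∈ faceIdeal k D ↔
      f ∈ faceIdeal k {A | A ∪ R ∈ D} := by
  simp only [mem_faceIdeal]
  constructor
  · intro h m hm A hA hmA
    refine h (expo R + m) (by rwa [coeff_monomial_mul, one_mul]) _ hA ?_
    rw [support_add_expo, Finset.union_comm]
    exact Finset.union_subset_union hmA subset_rfl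
  · intro h m hm A hA hmA
    rw [coeff_monomial_mul', one_mul] at hm
    split_ifs at hm with hle
    · have hRA : R ⊆ A := (expo_le_iff.1 hle).trans hmA
      refine h _ hm A ?_ ((Finsupp.support_mono tsub_le_self).trans hmA)
      change A ∪ R ∈ D
      rwa [Finset.union_eq_left.2 hRA]
    · exact hm rfl

/-- The short exact sequence `0 → S/(I : x^R)(-R) → S/I → S/(I + (x^R)) → 0` of a squarefree
monomial ideal and a squarefree monomial. -/
theorem exists_isGradedExact {D : Set (Finset (Vertex n))} (hD : IsLowerSet D)
    (R : Finset (Vertex n)) : ∃ (i : (Cox k n ⧸ faceIdeal k {A | A ∪ R ∈ D}) →ₗ[Cox k n] (Cox k n ⧸ faceIdeal k D))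
      (p : (Cox k n ⧸ faceIdeal k D) →ₗ[Cox k n]
        (Cox k n ⧸ faceIdeal k {A | A ∈ D ∧ ¬ R ⊆ A})), IsGradedExact
      (fun δ => quotGr (faceIdeal k {A | A ∪ R ∈ D})
        (δ - Finsupp.weight (multideg n) (expo R)))
      (quotGr (faceIdeal k D)) (quotGr (faceIdeal k {A | A ∈ D ∧ ¬ R ⊆ A})) i p := by
  have hle : faceIdeal k D ≤ faceIdeal k {A | A ∈ D ∧ ¬ R ⊆ A} := fun f hf =>
    mem_faceIdeal.2 fun m hm A hA => mem_faceIdeal.1 hf m hm A hA.1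
  have hmul : faceIdeal k {A | A ∪ R ∈ D} ≤ Submodule.comap
      (LinearMap.mulLeft (Cox k n) (monomial (expo R) (1 : k))) (faceIdeal k D) := fun f hf =>
    monomial_expo_mul_mem_iff.2 hf
  have hx : monomial (expo R) (1 : k) ∈ coxGrading k n (Finsupp.weight (multideg n) (expo R)) :=
    isWeightedHomogeneous_monomial _ _ _ rfl
  refine ⟨Submodule.mapQ _ _ (LinearMap.mulLeft (Cox k n) (monomial (expo R) (1 : k))) hmul,
    Submodule.factor hle, ?_, ?_, ?_, ?_, ?_, ?_⟩
  · rw [injective_iff_map_eq_zero]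
    intro x hx0
    obtain ⟨f, rfl⟩ := Submodule.Quotient.mk_surjective _ x
    rw [Submodule.mapQ_apply, Submodule.Quotient.mk_eq_zero] at hx0
    rw [Submodule.Quotient.mk_eq_zero]
    exact monomial_expo_mul_mem_iff.1 hx0
  · ext x
    obtain ⟨f, rfl⟩ := Submodule.Quotient.mk_surjective _ x
    constructor
    · intro h
      have hf : f ∈ faceIdeal k {A | A ∈ D ∧ ¬ R ⊆ A} := (Submodule.Quotient.mk_eq_zero _).1 h
      refine ⟨Submodule.Quotient.mk (f.divMonomial (expo R)), ?_⟩
      -- The preimage is the quotient of `f` by x^R. The remainder consists of the monomials of `f`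
      -- not divisible by x^R, and those already lie in the smaller ideal.
      rw [Submodule.mapQ_apply, LinearMap.mulLeft_apply, eq_comm, Submodule.Quotient.eq]
      have hsub : f - monomial (expo R) 1 * f.divMonomial (expo R) = f.modMonomial (expo R) := by
        rw [sub_eq_iff_eq_add, add_comm]
        exact (divMonomial_add_modMonomial f (expo R)).symm
      rw [hsub, mem_faceIdeal_of_isLowerSet hD]
      intro m hm hmD
      by_cases hle : expo R ≤ m
      · exact hm (coeff_modMonomial_of_le _ hle)
      · rw [coeff_modMonomial_of_not_le _ hle] at hm
        exact mem_faceIdeal.1 hf m hm m.support ⟨hmD, fun hR => hle (expo_le_iff.2 hR)⟩ subset_rfl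
    · rintro ⟨y, hy⟩
      obtain ⟨h, rfl⟩ := Submodule.Quotient.mk_surjective _ y
      rw [← hy, LinearMap.mem_ker, Submodule.mapQ_apply, LinearMap.mulLeft_apply]
      refine (Submodule.Quotient.mk_eq_zero _).2 (mem_faceIdeal.2 fun m hm A hA hmA => ?_)
      have hm' : coeff m (monomial (expo R) 1 * h) ≠ 0 := hm
      rw [coeff_monomial_mul'] at hm'
      split_ifs at hm' with hle
      · exact hA.2 ((expo_le_iff.1 hle).trans hmA)
      · exact hm' rfl
  · intro δ x
    obtain ⟨f, rfl⟩ := Ideal.Quotient.mk_surjective x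
    constructor
    · intro h
      obtain ⟨h, hh, hfh⟩ := mk_mem_quotGr.1 h
      -- Only the class of x^R `f` is known to be homogeneous. A monomial of `f` of the wrong degree
      -- cannot cancel against `h` after multiplication by x^R, so it lies in the colon ideal and
      -- can be dropped.
      refine mk_mem_quotGr.2 ⟨weightedHomogeneousComponent (multideg n)
        (δ - Finsupp.weight (multideg n) (expo R)) f, weightedHomogeneousComponent_mem _ _ _,
        mem_faceIdeal.2 fun m hm A hA hmA => ?_⟩
      rw [coeff_sub, coeff_weightedHomogeneousComponent] at hm
      split_ifs at hm with hw
      · exact hm (sub_self _)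
      · rw [sub_zero] at hm
        refine mem_faceIdeal.1 hfh (expo R + m) ?_ _ hA ?_
        · rw [LinearMap.mulLeft_apply, coeff_sub, coeff_monomial_mul, one_mul,
            IsWeightedHomogeneous.coeff_eq_zero hh, sub_zero]
          · exact hm
          · rw [map_add]
            exact fun h => hw (eq_sub_of_add_eq' h)
        · rw [support_add_expo, Finset.union_comm]
          exact Finset.union_subset_union hmA subset_rfl
    · intro h
      obtain ⟨h, hh, hfh⟩ := mk_mem_quotGr.1 h
      refine mk_mem_quotGr.2 ⟨monomial (expo R) 1 * h, ?_, ?_⟩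
      · have := mul_mem_coxGrading hx hh
        rwa [add_sub_cancel] at this
      · rw [LinearMap.mulLeft_apply, ← mul_sub]
        exact monomial_expo_mul_mem_iff.2 hfh
  · intro y
    obtain ⟨f, rfl⟩ := Submodule.Quotient.mk_surjective _ y
    exact ⟨Submodule.Quotient.mk f, rfl⟩
  · rintro δ _ ⟨h, hh, rfl⟩
    exact ⟨h, hh, rfl⟩
  · rintro δ _ ⟨h, hh, rfl⟩
    exact ⟨Ideal.Quotient.mk _ h, ⟨h, hh, rfl⟩, rfl⟩

variable (k) in
/-- `S/I` has a graded free resolution of length at most `c`, where `I` is the squarefree monomial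
ideal of `D`. -/
def FaceRes (c : ℕ) (D : Set (Finset (Vertex n))) : Prop :=
  HasRes k n (c + 1) (Cox k n ⧸ faceIdeal k D) (quotGr (faceIdeal k D))

theorem FaceRes.mono {c c' : ℕ} {D : Set (Finset (Vertex n))} (h : FaceRes k c D) (hc : c ≤ c') :
    FaceRes k c' D :=
  HasRes.mono h (by omega)

theorem faceRes_empty (c : ℕ) : FaceRes k c (∅ : Set (Finset (Vertex n))) := by
  refine HasRes.of_subsingleton _ _ _ ?_
  have : faceIdeal k (∅ : Set (Finset (Vertex n))) = ⊤ := by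
    ext f
    simp [mem_faceIdeal]
  rw [this]
  infer_instance

theorem faceRes_univ : FaceRes k 0 (Set.univ : Set (Finset (Vertex n))) := by
  have h0 : faceIdeal k (Set.univ : Set (Finset (Vertex n))) = ⊥ := by
    rw [eq_bot_iff]
    intro f hf
    rw [Ideal.mem_bot, MvPolynomial.ext_iff]
    intro m
    by_contra hm
    exact mem_faceIdeal.1 hf m hm m.support (Set.mem_univ _) subset_rfl
  unfold FaceRes
  rw [h0]
  refine (hasRes_one_free (fun _ : Unit => (0 : Fin r → ℤ))).of_equiv (isGradedFamily_quotGr _)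
    ((Submodule.quotEquivOfEqBot (⊥ : Ideal (Cox k n)) rfl).trans
      (Finsupp.uniqueLinearEquiv (Cox k n) (Cox k n) ()).symm) ?_
  intro δ x
  obtain ⟨f, rfl⟩ := Ideal.Quotient.mk_surjective x
  rw [mk_mem_quotGr, mem_freeGr]
  have he : ((Submodule.quotEquivOfEqBot (⊥ : Ideal (Cox k n)) rfl).trans
      (Finsupp.uniqueLinearEquiv (Cox k n) (Cox k n) ()).symm)
      (Ideal.Quotient.mk ⊥ f) () = f := by
    have h1 : (Submodule.quotEquivOfEqBot (⊥ : Ideal (Cox k n)) rfl)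
      (Ideal.Quotient.mk ⊥ f) = f := rfl
    rw [LinearEquiv.trans_apply, h1]
    exact Finsupp.single_eq_same
  constructor
  · rintro ⟨h, hh, hfh⟩ ⟨⟩
    rw [he, sub_zero, sub_eq_zero.1 ((Submodule.mem_bot _).1 hfh)]
    exact hh
  · intro h
    have := h ()
    rw [he, sub_zero] at this
    exact ⟨f, this, by rw [sub_self]; exact zero_mem _⟩

/-- The horseshoe lemma for the sequence of the link and the deletion; the degree shift of the link
does not affect lengths. -/
theorem FaceRes.of_link_of_deletion {c : ℕ} {D : Set (Finset (Vertex n))} (hD : IsLowerSet D)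
    (R : Finset (Vertex n)) (hlink : FaceRes k c {A | A ∪ R ∈ D})
    (hdel : FaceRes k c {A | A ∈ D ∧ ¬ R ⊆ A}) : FaceRes k c D := by
  obtain ⟨i, p, h⟩ := exists_isGradedExact (k := k) hD R
  exact HasRes.of_exact (isGradedFamily_quotGr _) h (HasRes.shift _ hlink) hdel

/-- The same sequence with the deletion as the quotient, which costs one step; this is how a Koszul
complex grows by a variable. -/
theorem FaceRes.deletion {c : ℕ} {D : Set (Finset (Vertex n))} (hD : IsLowerSet D)
    (R : Finset (Vertex n)) (hlink : FaceRes k c {A | A ∪ R ∈ D})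
    (h : FaceRes k c D) : FaceRes k (c + 1) {A | A ∈ D ∧ ¬ R ⊆ A} := by
  obtain ⟨i, p, he⟩ := exists_isGradedExact (k := k) hD R
  exact HasRes.quotient he (HasRes.shift _ hlink) (HasRes.succ h)

end MonomialIdeals

/-! ### Bounds for projective dimensions by links and deletions. -/

section Combinatorics

variable (k : Type u) [Field k] {r : ℕ} {n : Fin r → ℕ}

/-- A set of vertices with exactly one vertex in each component. -/
def IsTransversal (σ : Finset (Vertex n)) : Prop := ∀ i : Fin r, ∃! v : Vertex n, v ∈ σ ∧ v.1 = i

namespace IsTransversal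

variable {σ τ A : Finset (Vertex n)}

theorem eq_of_fst_eq (hσ : IsTransversal σ) {v w : Vertex n} (hv : v ∈ σ) (hw : w ∈ σ)
    (h : v.1 = w.1) : v = w :=
  (hσ w.1).unique ⟨hv, h⟩ ⟨hw, rfl⟩

theorem eq_of_subset_of_meets (hσ : IsTransversal σ) (hA : A ⊆ σ)
    (h : ¬ ∃ l, ∀ v ∈ A, v.1 ≠ l) : A = σ := by
  refine hA.antisymm fun v hv => ?_
  push Not at h
  obtain ⟨w, hw, hwv⟩ := h v.1
  rwa [hσ.eq_of_fst_eq hv (hA hw) hwv.symm]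

theorem meets (hσ : IsTransversal σ) (hA : σ ⊆ A) : ¬ ∃ l, ∀ v ∈ A, v.1 ≠ l := by
  rintro ⟨l, hl⟩
  obtain ⟨v, ⟨hv, hvl⟩, -⟩ := hσ l
  exact hl v (hA hv) hvl

theorem eq_of_subset (hσ : IsTransversal σ) (hτ : IsTransversal τ) (h : σ ⊆ τ) : σ = τ :=
  hτ.eq_of_subset_of_meets h (hσ.meets subset_rfl)

theorem card_eq (hσ : IsTransversal σ) : σ.card = r := by
  have h : σ.card = (Finset.univ : Finset (Fin r)).card := by
    refine Finset.card_bij (fun v _ => v.1) (fun _ _ => Finset.mem_univ _)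
      (fun v hv w hw h => hσ.eq_of_fst_eq hv hw h) fun i _ => ?_
    obtain ⟨v, ⟨hv, hvi⟩, -⟩ := hσ i
    exact ⟨v, hv, hvi⟩
  rw [h, Finset.card_univ, Fintype.card_fin]

end IsTransversal

theorem card_vertex : (Finset.univ : Finset (Vertex n)).card = (∑ i, n i) + r := by
  rw [Finset.card_univ, Fintype.card_sigma]
  simp [Finset.sum_add_distrib]

/-- The quotient by an ideal generated by variables is resolved by a Koszul complex. -/
theorem faceRes_disjoint (W : Finset (Vertex n)) : FaceRes k W.card {A | Disjoint A W} := by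
  induction W using Finset.induction_on with
  | empty =>
    have : {A : Finset (Vertex n) | Disjoint A ∅} = Set.univ := by
      ext A
      simp
    rw [this]
    exact faceRes_univ
  | insert v W hv ih =>
    rw [Finset.card_insert_of_notMem hv]
    have hD : IsLowerSet {A | Disjoint A W} := fun A B hBA hA =>
      Finset.disjoint_of_subset_left hBA hA
    -- For v ∉ W the variable of v is a nonzerodivisor modulo the variables of W, so the link is the
    -- complex itself.
    have hlink : {A | A ∪ {v} ∈ {A | Disjoint A W}} = {A | Disjoint A W} := by
      ext A
      change Disjoint (A ∪ {v}) W ↔ Disjoint A W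
      simp [hv]
    have hdel : {A | A ∈ {A | Disjoint A W} ∧ ¬ {v} ⊆ A} = {A | Disjoint A (insert v W)} := by
      ext A
      change Disjoint A W ∧ ¬ {v} ⊆ A ↔ Disjoint A (insert v W)
      rw [Finset.disjoint_insert_right, Finset.singleton_subset_iff, and_comm]
    have := FaceRes.deletion hD {v} (by rwa [hlink]) ih
    rwa [hdel] at this

/-- The sets of vertices that are disjoint from `W` and have no vertex in some component from
`L`. -/
def missing (L : Finset (Fin r)) (W : Finset (Vertex n)) : Set (Finset (Vertex n)) :=
  {A | Disjoint A W ∧ ∃ l ∈ L, ∀ v ∈ A, v.1 ≠ l}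

theorem isLowerSet_missing (L : Finset (Fin r)) (W : Finset (Vertex n)) :
    IsLowerSet (missing L W) := by
  rintro A B hBA ⟨hA, l, hl, h⟩
  exact ⟨Finset.disjoint_of_subset_left hBA hA, l, hl, fun v hv => h v (hBA hv)⟩

theorem missing_link (L : Finset (Fin r)) {W : Finset (Vertex n)} {v : Vertex n} (hv : v ∉ W) :
    {A | A ∪ {v} ∈ missing L W} = missing (L.erase v.1) W := by
  ext A
  constructor
  · rintro ⟨hA, l, hl, h⟩
    have hvl : v.1 ≠ l := h v (by simp)
    exact ⟨(Finset.disjoint_union_left.1 hA).1, l, Finset.mem_erase.2 ⟨hvl.symm, hl⟩,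
      fun w hw => h w (Finset.mem_union_left _ hw)⟩
  · rintro ⟨hA, l, hl, h⟩
    obtain ⟨hlv, hl⟩ := Finset.mem_erase.1 hl
    refine ⟨Finset.disjoint_union_left.2 ⟨hA, Finset.disjoint_singleton_left.2 hv⟩, l, hl,
      fun w hw => ?_⟩
    rcases Finset.mem_union.1 hw with hw | hw
    · exact h w hw
    · rw [Finset.mem_singleton.1 hw]
      exact hlv.symm

theorem missing_deletion (L : Finset (Fin r)) (W : Finset (Vertex n)) (v : Vertex n) :
    {A | A ∈ missing L W ∧ ¬ {v} ⊆ A} = missing L (insert v W) := by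
  ext A
  change (Disjoint A W ∧ _) ∧ ¬ {v} ⊆ A ↔ Disjoint A (insert v W) ∧ _
  rw [Finset.disjoint_insert_right, Finset.singleton_subset_iff]
  tauto

/-- The ideal is generated by the variables of W and the intersection of the component ideals for l
in L. The bound is the number of variables involved, minus |L| - 1. The vertices `s l` outside W
ensure that no component of L is used up by W at the start. -/
theorem faceRes_missing (s : ∀ i : Fin r, Fin (n i + 1)) (L : Finset (Fin r)) :
    ∀ (W : Finset (Vertex n)) (c : ℕ), (∀ l ∈ L, (⟨l, s l⟩ : Vertex n) ∉ W) →
      (W ∪ Finset.univ.filter fun v => v.1 ∈ L).card + 1 ≤ c + L.card →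
      FaceRes k c (missing L W) := by
  induction L using Finset.induction_on with
  | empty =>
    intro W c _ _
    have : missing ∅ W = ∅ := by
      ext A
      simp [missing]
    rw [this]
    exact faceRes_empty c
  | insert l L hl ih =>
    intro W c hW
    replace hW : ∀ l' ∈ L, (⟨l', s l'⟩ : Vertex n) ∉ W :=
      fun l' hl' => hW l' (Finset.mem_insert_of_mem hl')
    -- The vertices of the component l are moved into W one by one. Each link drops l from L; once
    -- the component is exhausted, every set disjoint from W misses l and a simplex remains.
    induction hm : ((Finset.univ.filter fun v : Vertex n => v.1 = l) \ W).card generalizing W with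
    | zero =>
      intro hc
      rw [Finset.card_eq_zero, Finset.sdiff_eq_empty_iff_subset] at hm
      have hset : missing (insert l L) W = {A | Disjoint A W} := by
        ext A
        refine ⟨fun h => h.1, fun h => ⟨h, l, Finset.mem_insert_self _ _, fun v hv hvl => ?_⟩⟩
        exact Finset.disjoint_left.1 h hv (hm (by simp [hvl]))
      rw [hset]
      refine (faceRes_disjoint k W).mono ?_
      -- The |L| vertices `s l'` are counted on the left of the hypothesis but are not in W, which
      -- gives |W| ≤ c.
      have hdisj : Disjoint W (L.image fun l' => (⟨l', s l'⟩ : Vertex n)) := by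
        rw [Finset.disjoint_right]
        intro v hv
        obtain ⟨l', hl', rfl⟩ := Finset.mem_image.1 hv
        exact hW l' hl'
      have hsub : W ∪ (L.image fun l' => (⟨l', s l'⟩ : Vertex n)) ⊆
          W ∪ Finset.univ.filter fun v => v.1 ∈ insert l L := by
        refine Finset.union_subset_union subset_rfl fun v hv => ?_
        obtain ⟨l', hl', rfl⟩ := Finset.mem_image.1 hv
        simp [hl']
      have h1 := Finset.card_le_card hsub
      rw [Finset.card_union_of_disjoint hdisj, Finset.card_image_of_injective _
        fun a b h => congrArg Sigma.fst h] at h1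
      rw [Finset.card_insert_of_notMem hl] at hc
      omega
    | succ m ihm =>
      intro hc
      obtain ⟨v, hv⟩ : ((Finset.univ.filter fun v : Vertex n => v.1 = l) \ W).Nonempty :=
        Finset.card_pos.1 (by omega)
      obtain ⟨hvl, hvW⟩ := Finset.mem_sdiff.1 hv
      replace hvl : v.1 = l := (Finset.mem_filter.1 hvl).2
      refine FaceRes.of_link_of_deletion (isLowerSet_missing _ _) {v} ?_ ?_
      · rw [missing_link _ hvW, hvl, Finset.erase_insert hl]
        refine ih W c hW ?_
        have hvL : v ∉ W ∪ Finset.univ.filter fun v => v.1 ∈ L := by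
          simp [hvW, hvl, hl]
        -- Dropping l lowers |L| by one, and the vertex v, no longer counted, pays for it.
        have hsub : insert v (W ∪ Finset.univ.filter fun v => v.1 ∈ L) ⊆
            W ∪ Finset.univ.filter fun v => v.1 ∈ insert l L := by
          intro w hw
          simp only [Finset.mem_insert, Finset.mem_union, Finset.mem_filter, Finset.mem_univ,
            true_and] at hw ⊢
          rcases hw with rfl | hw | hw
          · exact Or.inr (Or.inl hvl)
          · exact Or.inl hw
          · exact Or.inr (Or.inr hw)
        have h1 := Finset.card_le_card hsub
        rw [Finset.card_insert_of_notMem hvL] at h1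
        rw [Finset.card_insert_of_notMem hl] at hc
        omega
      · rw [missing_deletion]
        refine ihm (insert v W) (fun l' hl' => ?_) ?_ ?_
        · rw [Finset.mem_insert, not_or]
          refine ⟨fun h => ?_, hW l' hl'⟩
          rw [← h] at hvl
          exact hl (hvl ▸ hl')
        · rw [Finset.sdiff_insert, Finset.card_erase_of_mem hv, hm, Nat.add_sub_cancel]
        · rwa [Finset.insert_union, Finset.insert_eq_of_mem]
          simp [hvl]

/-- The sets that are disjoint from `W` and are contained in `σ` or miss some component. -/
theorem faceRes_subset_or_missing {σ : Finset (Vertex n)} (hσ : IsTransversal σ) :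
    ∀ W : Finset (Vertex n), Disjoint σ W →
      FaceRes k (∑ i, n i) {A | Disjoint A W ∧ (A ⊆ σ ∨ ∃ l, ∀ v ∈ A, v.1 ≠ l)} := by
  have hs : ∀ i : Fin r, ∃ j : Fin (n i + 1), (⟨i, j⟩ : Vertex n) ∈ σ := fun i => by
    obtain ⟨⟨i', j⟩, ⟨hv, rfl⟩, -⟩ := hσ i
    exact ⟨j, hv⟩
  choose s hs using hs
  intro W hW
  induction hm : (Finset.univ \ (σ ∪ W)).card generalizing W with
  | zero =>
    rw [Finset.card_eq_zero, Finset.sdiff_eq_empty_iff_subset, Finset.univ_subset_iff] at hm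
    have hset : {A | Disjoint A W ∧ (A ⊆ σ ∨ ∃ l, ∀ v ∈ A, v.1 ≠ l)} = {A | Disjoint A W} := by
      ext A
      refine ⟨fun h => h.1, fun h => ⟨h, Or.inl fun v hv => ?_⟩⟩
      have hv' : v ∈ σ ∪ W := hm ▸ Finset.mem_univ v
      exact (Finset.mem_union.1 hv').resolve_right (Finset.disjoint_left.1 h hv)
    rw [hset]
    refine (faceRes_disjoint k W).mono ?_
    -- Now W is the complement of σ and has |n| + r - r elements.
    have h1 := Finset.card_union_of_disjoint hW
    rw [hm, card_vertex, hσ.card_eq] at h1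
    omega
  | succ m ih =>
    obtain ⟨v, hv⟩ : (Finset.univ \ (σ ∪ W)).Nonempty := Finset.card_pos.1 (by omega)
    have hv' := hv
    simp only [Finset.mem_sdiff, Finset.mem_univ, Finset.mem_union, true_and, not_or] at hv'
    obtain ⟨hvσ, hvW⟩ := hv'
    have hlow : IsLowerSet {A | Disjoint A W ∧ (A ⊆ σ ∨ ∃ l, ∀ v ∈ A, v.1 ≠ l)} := by
      rintro A B hBA ⟨hA, h⟩
      refine ⟨Finset.disjoint_of_subset_left hBA hA, h.imp (fun h => Finset.Subset.trans hBA h) ?_⟩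
      rintro ⟨l, hl⟩
      exact ⟨l, fun v hv => hl v (hBA hv)⟩
    refine FaceRes.of_link_of_deletion hlow {v} ?_ ?_
    · have hlink : {A | A ∪ {v} ∈ {A | Disjoint A W ∧ (A ⊆ σ ∨ ∃ l, ∀ v ∈ A, v.1 ≠ l)}} =
          missing (Finset.univ.erase v.1) W := by
        rw [← missing_link _ hvW]
        ext A
        change _ ∧ (_ ∨ _) ↔ _ ∧ _
        have : ¬ A ∪ {v} ⊆ σ := fun h => hvσ (h (by simp))
        simp only [this, false_or, Finset.mem_univ, true_and]
      rw [hlink]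
      refine faceRes_missing k s _ W _ (fun l _ => Finset.disjoint_left.1 hW (hs l)) ?_
      -- The component of v contains two distinct vertices outside W, v and its vertex in σ. The
      -- link loses both from the count and only one component, which brings the bound down from |n|
      -- + 1 to |n|.
      have hsv : (⟨v.1, s v.1⟩ : Vertex n) ∉ W ∪ Finset.univ.filter fun w => w.1 ∈
          Finset.univ.erase v.1 := by
        simp [Finset.disjoint_left.1 hW (hs v.1)]
      have hvv : v ∉ insert (⟨v.1, s v.1⟩ : Vertex n) (W ∪ Finset.univ.filter fun w => w.1 ∈
          Finset.univ.erase v.1) := by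
        rw [Finset.mem_insert, not_or]
        refine ⟨fun h => hvσ (h ▸ hs v.1), ?_⟩
        simp [hvW]
      have h1 := Finset.card_le_card (Finset.subset_univ (insert v (insert
        (⟨v.1, s v.1⟩ : Vertex n) (W ∪ Finset.univ.filter fun w => w.1 ∈
          Finset.univ.erase v.1))))
      rw [Finset.card_insert_of_notMem hvv, Finset.card_insert_of_notMem hsv, card_vertex] at h1
      have h2 : (Finset.univ.erase v.1).card = r - 1 := by
        rw [Finset.card_erase_of_mem (Finset.mem_univ _), Finset.card_univ, Fintype.card_fin]
      have h3 : 0 < r := v.1.pos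
      omega
    · have hdel : {A | A ∈ {A | Disjoint A W ∧ (A ⊆ σ ∨ ∃ l, ∀ v ∈ A, v.1 ≠ l)} ∧ ¬ {v} ⊆ A} =
          {A | Disjoint A (insert v W) ∧ (A ⊆ σ ∨ ∃ l, ∀ v ∈ A, v.1 ≠ l)} := by
        ext A
        change (Disjoint A W ∧ _) ∧ ¬ {v} ⊆ A ↔ Disjoint A (insert v W) ∧ _
        rw [Finset.disjoint_insert_right, Finset.singleton_subset_iff]
        tauto
      rw [hdel]
      refine ih (insert v W) (Finset.disjoint_insert_right.2 ⟨hvσ, hW⟩) ?_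
      rw [Finset.union_insert, Finset.sdiff_insert, Finset.card_erase_of_mem hv, hm,
        Nat.add_sub_cancel]

/-- The sets of vertices that are contained in a member of `Φ` or miss some component. -/
def generatedOrMissing (Φ : Set (Finset (Vertex n))) : Set (Finset (Vertex n)) :=
  {A | (∃ σ ∈ Φ, A ⊆ σ) ∨ ∃ l, ∀ v ∈ A, v.1 ≠ l}

theorem isLowerSet_generatedOrMissing (Φ : Set (Finset (Vertex n))) :
    IsLowerSet (generatedOrMissing Φ) := by
  rintro A B hBA (⟨σ, hσ, h⟩ | ⟨l, hl⟩)
  · exact Or.inl ⟨σ, hσ, Finset.Subset.trans hBA h⟩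
  · exact Or.inr ⟨l, fun v hv => hl v (hBA hv)⟩

/-- The facet σ₀ is kept apart since the induction must start from one facet: without any, the
complex is that of B, for which `faceRes_missing` gives only |n| + 1. -/
theorem faceRes_generatedOrMissing {σ₀ : Finset (Vertex n)} (hσ₀ : IsTransversal σ₀)
    (Φ : Finset (Finset (Vertex n))) : (∀ σ ∈ Φ, IsTransversal σ) →
      FaceRes k (∑ i, n i) (generatedOrMissing (insert σ₀ (Φ : Set (Finset (Vertex n))))) := by
  induction Φ using Finset.induction_on with
  | empty =>
    intro _
    have h := faceRes_subset_or_missing k hσ₀ ∅ (Finset.disjoint_empty_right _)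
    have hset : generatedOrMissing (insert σ₀ ((∅ : Finset (Finset (Vertex n))) : Set _)) =
        {A | Disjoint A ∅ ∧ (A ⊆ σ₀ ∨ ∃ l, ∀ v ∈ A, v.1 ≠ l)} := by
      ext A
      simp [generatedOrMissing]
    rwa [hset]
  | insert σ Φ hσΦ ih =>
    intro hΦ
    have hσ := hΦ σ (Finset.mem_insert_self _ _)
    specialize ih fun τ hτ => hΦ τ (Finset.mem_insert_of_mem hτ)
    rw [Finset.coe_insert, Set.insert_comm]
    have htr : ∀ τ ∈ insert σ₀ (Φ : Set (Finset (Vertex n))), IsTransversal τ := by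
      rintro τ (rfl | hτ)
      · exact hσ₀
      · exact hΦ τ (Finset.mem_insert_of_mem hτ)
    by_cases hσ' : σ ∈ insert σ₀ (Φ : Set (Finset (Vertex n)))
    · rwa [Set.insert_eq_of_mem hσ']
    generalize insert σ₀ (Φ : Set (Finset (Vertex n))) = Ψ at *
    refine FaceRes.of_link_of_deletion (isLowerSet_generatedOrMissing _) σ ?_ ?_
    · have hlink : {A | A ∪ σ ∈ generatedOrMissing (insert σ Ψ)} = {A | Disjoint A σᶜ} := by
        ext A
        change A ∪ σ ∈ generatedOrMissing (insert σ Ψ) ↔ Disjoint A σᶜ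
        rw [← Finset.subset_compl_iff_disjoint_right, compl_compl]
        constructor
        · rintro (⟨τ, hτ, h⟩ | h)
          · have hτt : IsTransversal τ := by
              rcases hτ with rfl | hτ
              · exact hσ
              · exact htr τ hτ
            rw [hσ.eq_of_subset hτt (Finset.subset_union_right.trans h)]
            exact Finset.subset_union_left.trans h
          · exact absurd h (hσ.meets Finset.subset_union_right)
        · intro h
          exact Or.inl ⟨σ, Set.mem_insert _ _, Finset.union_subset h subset_rfl⟩
      rw [hlink]
      refine (faceRes_disjoint k σᶜ).mono (le_of_eq ?_)
      rw [Finset.card_compl, hσ.card_eq, ← Finset.card_univ, card_vertex, Nat.add_sub_cancel]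
    · have hdel : {A | A ∈ generatedOrMissing (insert σ Ψ) ∧ ¬ σ ⊆ A} = generatedOrMissing Ψ := by
        ext A
        constructor
        · rintro ⟨⟨τ, rfl | hτ, h⟩ | h, hA⟩
          · by_cases hm : ∃ l, ∀ v ∈ A, v.1 ≠ l
            · exact Or.inr hm
            · exact absurd (hσ.eq_of_subset_of_meets h hm).symm.subset hA
          · exact Or.inl ⟨τ, hτ, h⟩
          · exact Or.inr h
        · rintro (⟨τ, hτ, h⟩ | h)
          · refine ⟨Or.inl ⟨τ, Set.mem_insert_of_mem _ hτ, h⟩, fun hA => hσ' ?_⟩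
            rwa [hσ.eq_of_subset (htr τ hτ) (hA.trans h)]
          · exact ⟨Or.inr h, fun hA => hσ.meets hA h⟩
      rwa [hdel]

end Combinatorics

open MvPolynomial

/-! ### The Stanley–Reisner ideal of a balanced complex -/

section StanleyReisner

variable {k : Type u} [Field k] {r : ℕ} {n : Fin r → ℕ}
  {Δ : PreAbstractSimplicialComplex (Vertex n)}

theorem mem_of_subset_of_nonempty {σ τ : Finset (Vertex n)} (hσ : σ ∈ Δ) (h : τ ⊆ σ)
    (hτ : τ.Nonempty) : τ ∈ Δ :=
  (Δ.isRelLowerSet_faces hσ).2 h hτ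

theorem exists_isFacet_of_mem {σ : Finset (Vertex n)} (hσ : σ ∈ Δ) :
    ∃ τ, IsFacet Δ τ ∧ σ ⊆ τ := by
  obtain ⟨τ, hτ, h⟩ := (Set.toFinite {τ | τ ∈ Δ}).exists_le_maximal hσ
  exact ⟨τ, h, hτ⟩

variable (Δ) in
/-- The faces of `Δ`, including the empty set if `Δ` has a face. -/
def facesOf : Set (Finset (Vertex n)) := {A | ∃ σ, IsFacet Δ σ ∧ A ⊆ σ}

theorem isLowerSet_facesOf : IsLowerSet (facesOf Δ) := by
  rintro A B hBA ⟨σ, hσ, h⟩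
  exact ⟨σ, hσ, Finset.Subset.trans hBA h⟩

theorem monomial_expo (R : Finset (Vertex n)) :
    monomial (expo R) (1 : k) = ∏ v ∈ R, (X v : Cox k n) := by
  rw [monomial_eq, C_1, one_mul, Finsupp.prod, support_expo]
  refine Finset.prod_congr rfl fun v hv => ?_
  rw [expo, Finsupp.indicator_of_mem hv, pow_one]

theorem stanleyReisnerIdeal_eq (hne : ∃ σ, σ ∈ Δ) :
    stanleyReisnerIdeal k Δ = faceIdeal k (facesOf Δ) := by
  apply le_antisymm
  · refine Ideal.span_le.2 ?_
    rintro _ ⟨τ, hτ, hτΔ, rfl⟩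
    refine (mem_faceIdeal_of_isLowerSet isLowerSet_facesOf).2 fun m hm => ?_
    rw [← monomial_expo, coeff_monomial] at hm
    split_ifs at hm with h
    · subst h
      rw [support_expo]
      rintro ⟨σ, hσ, h⟩
      exact hτΔ (mem_of_subset_of_nonempty hσ.prop h hτ)
    · exact absurd rfl hm
  · intro f hf
    rw [← support_sum_monomial_coeff f]
    refine Ideal.sum_mem _ fun m hm => ?_
    have hmD := (mem_faceIdeal_of_isLowerSet isLowerSet_facesOf).1 hf m
      (MvPolynomial.mem_support_iff.1 hm)
    have hgen : monomial (expo m.support) (1 : k) ∈ stanleyReisnerIdeal k Δ := by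
      refine Ideal.subset_span ⟨m.support, ?_, fun h => hmD ?_, monomial_expo _⟩
      -- The generators come from non-empty non-faces only; a constant term is excluded because the
      -- existing face puts ∅ into `facesOf Δ`.
      · rw [Finset.nonempty_iff_ne_empty]
        intro h
        obtain ⟨σ, hσ⟩ := hne
        obtain ⟨τ, hτ, -⟩ := exists_isFacet_of_mem hσ
        exact hmD ⟨τ, hτ, h ▸ Finset.empty_subset τ⟩
      · exact exists_isFacet_of_mem h
    have hle : expo m.support ≤ m := expo_le_iff.2 subset_rfl
    have : monomial m (coeff m f) =
        monomial (m - expo m.support) (coeff m f) * monomial (expo m.support) 1 := by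
      rw [monomial_mul, mul_one, tsub_add_cancel_of_le hle]
    rw [this]
    exact Ideal.mul_mem_left _ _ hgen

theorem mem_span_range_X_iff {i : Fin r} {f : Cox k n} :
    f ∈ Ideal.span (Set.range fun j : Fin (n i + 1) => (X (⟨i, j⟩ : Vertex n) : Cox k n)) ↔
      ∀ m, coeff m f ≠ 0 → ∃ v ∈ m.support, v.1 = i := by
  have h : (Set.range fun j : Fin (n i + 1) => (X (⟨i, j⟩ : Vertex n) : Cox k n)) =
      X '' {v : Vertex n | v.1 = i} := by
    ext g
    constructor
    · rintro ⟨j, rfl⟩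
      exact ⟨⟨i, j⟩, rfl, rfl⟩
    · rintro ⟨⟨i', j⟩, rfl, rfl⟩
      exact ⟨j, rfl⟩
  rw [h, mem_ideal_span_X_image]
  simp only [MvPolynomial.mem_support_iff, Finsupp.mem_support_iff, ne_eq]
  refine forall₂_congr fun m _ => exists_congr fun v => ?_
  exact and_comm

theorem mem_irrelevantIdeal_iff {f : Cox k n} :
    f ∈ irrelevantIdeal k n ↔ ∀ m, coeff m f ≠ 0 → ¬ ∃ l, ∀ v ∈ m.support, v.1 ≠ l := by
  rw [irrelevantIdeal, Ideal.mem_iInf]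
  simp only [mem_span_range_X_iff]
  push Not
  exact ⟨fun h m hm l => h l m hm, fun h l m hm => h m hm l⟩

theorem monomial_expo_mem_irrelevantIdeal {σ : Finset (Vertex n)} (hσ : IsTransversal σ) :
    monomial (expo σ) (1 : k) ∈ irrelevantIdeal k n := by
  refine mem_irrelevantIdeal_iff.2 fun m hm => ?_
  rw [coeff_monomial] at hm
  split_ifs at hm with h
  · subst h
    rw [support_expo]
    exact hσ.meets subset_rfl
  · exact absurd rfl hm

/-- The Stanley–Reisner ideal of a balanced complex is saturated. -/
theorem mem_faceIdeal_of_pow_mul_mem (hbal : IsBalanced Δ) {f : Cox k n} (a : ℕ)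
    (h : ∀ b ∈ irrelevantIdeal k n ^ a, b * f ∈ faceIdeal k (facesOf Δ)) :
    f ∈ faceIdeal k (facesOf Δ) := by
  refine (mem_faceIdeal_of_isLowerSet isLowerSet_facesOf).2 fun m hm hmD => ?_
  obtain ⟨σ, hσ, hmσ⟩ := hmD
  -- The monomial of a facet σ lies in B because σ meets every component, and multiplying by its
  -- powers keeps the support of `m` inside σ.
  have hb := h _ (Ideal.pow_mem_pow (monomial_expo_mem_irrelevantIdeal (k := k) (hbal σ hσ)) a)
  rw [monomial_pow, one_pow] at hb
  refine mem_faceIdeal.1 hb (a • expo σ + m) ?_ σ ⟨σ, hσ, subset_rfl⟩ ?_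
  · rwa [coeff_monomial_mul, one_mul]
  · refine Finsupp.support_add.trans (Finset.union_subset ?_ hmσ)
    exact Finsupp.support_smul.trans (support_expo σ).subset

theorem isBSaturated (hne : ∃ σ, σ ∈ Δ) (hbal : IsBalanced Δ) : IsBSaturated k Δ := by
  rw [IsBSaturated, stanleyReisnerIdeal_eq hne]
  apply le_antisymm
  · refine iSup_le fun a f hf => mem_faceIdeal_of_pow_mul_mem hbal a fun b hb => ?_
    rw [mul_comm]
    exact Submodule.mem_colon.1 hf b hb
  · refine le_trans (fun f hf => ?_) (le_iSup _ 0)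
    exact Submodule.mem_colon.2 fun s _ => Ideal.mul_mem_right _ _ hf

variable (k Δ) in
/-- The intersection of the Stanley–Reisner ideal with the irrelevant ideal. -/
def relevantIdeal : Ideal (Cox k n) := faceIdeal k (generatedOrMissing {σ | IsFacet Δ σ})

/-- B is itself the monomial ideal of the sets that miss a component, and intersecting monomial
ideals of complexes amounts to uniting the complexes. -/
theorem relevantIdeal_eq :
    relevantIdeal k Δ = faceIdeal k (facesOf Δ) ⊓ irrelevantIdeal k n := by
  ext f
  rw [Submodule.mem_inf, mem_irrelevantIdeal_iff,
    mem_faceIdeal_of_isLowerSet isLowerSet_facesOf, relevantIdeal,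
    mem_faceIdeal_of_isLowerSet (isLowerSet_generatedOrMissing _), ← forall₂_and]
  exact forall₂_congr fun m _ => not_or

theorem hasRes_relevantIdeal (hne : ∃ σ, σ ∈ Δ) (hbal : IsBalanced Δ) :
    HasRes k n ((∑ i, n i) + 1) (Cox k n ⧸ relevantIdeal k Δ) (quotGr (relevantIdeal k Δ)) := by
  obtain ⟨σ, hσ⟩ := hne
  obtain ⟨σ₀, hσ₀, -⟩ := exists_isFacet_of_mem hσ
  have hfin : {σ | IsFacet Δ σ}.Finite := Set.toFinite _
  have h := faceRes_generatedOrMissing k (hbal σ₀ hσ₀) hfin.toFinset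
    (fun τ hτ => hbal τ (hfin.mem_toFinset.1 hτ))
  rw [hfin.coe_toFinset, Set.insert_eq_of_mem (by exact hσ₀)] at h
  exact h

theorem nontrivial_quotient_relevantIdeal (hne : ∃ σ, σ ∈ Δ) :
    Nontrivial (Cox k n ⧸ relevantIdeal k Δ) := by
  rw [Ideal.Quotient.nontrivial_iff, Ne, Ideal.eq_top_iff_one]
  intro h
  obtain ⟨σ, hσ⟩ := hne
  obtain ⟨τ, hτ, -⟩ := exists_isFacet_of_mem hσ
  refine mem_faceIdeal.1 h 0 ?_ ∅ (Or.inl ⟨τ, hτ, Finset.empty_subset _⟩) (by simp)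
  rw [coeff_zero_one]
  exact one_ne_zero

/-- The elements of `S/(I ∩ B)` that are annihilated by a power of `B` are the classes of the
elements of `I`. -/
theorem mk_mem_torsionPart_relevantIdeal (hbal : IsBalanced Δ) {f : Cox k n} :
    Ideal.Quotient.mk (relevantIdeal k Δ) f ∈
      torsionPart (irrelevantIdeal k n) (Cox k n ⧸ relevantIdeal k Δ) ↔
      f ∈ faceIdeal k (facesOf Δ) := by
  have hsmul : ∀ b : Cox k n, b • Ideal.Quotient.mk (relevantIdeal k Δ) f = 0 ↔
      b * f ∈ relevantIdeal k Δ := fun b => Submodule.Quotient.mk_eq_zero (relevantIdeal k Δ)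
  constructor
  · rintro ⟨a, ha⟩
    refine mem_faceIdeal_of_pow_mul_mem hbal a fun b hb => ?_
    have := (hsmul b).1 (ha b hb)
    rw [relevantIdeal_eq] at this
    exact this.1
  · intro hf
    refine ⟨1, fun b hb => (hsmul b).2 ?_⟩
    rw [pow_one] at hb
    rw [relevantIdeal_eq]
    exact ⟨Ideal.mul_mem_left _ _ hf, Ideal.mul_mem_right _ _ hb⟩

theorem torsionPart_faceIdeal (hbal : IsBalanced Δ) :
    torsionPart (irrelevantIdeal k n) (Cox k n ⧸ faceIdeal k (facesOf Δ)) = ⊥ := by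
  rw [eq_bot_iff]
  rintro x ⟨a, ha⟩
  obtain ⟨f, rfl⟩ := Ideal.Quotient.mk_surjective x
  refine (Submodule.Quotient.mk_eq_zero _).2 (mem_faceIdeal_of_pow_mul_mem hbal a fun b hb => ?_)
  exact (Submodule.Quotient.mk_eq_zero (faceIdeal k (facesOf Δ))).1 (ha b hb)

/-- A graded free complex that resolves `S/(I ∩ B)` is a virtual resolution of `S/I`. -/
theorem isVirtualResolution_of_resolves (hbal : IsBalanced Δ) (F : GradedFreeComplex k n)
    (ε : F.term 0 →ₗ[Cox k n] (Cox k n ⧸ relevantIdeal k Δ))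
    (hexact : ∀ i, LinearMap.ker (F.d i) ≤ LinearMap.range (F.d (i + 1)))
    (hker : LinearMap.ker ε = LinearMap.range (F.d 0))
    (hε : IsGradedSurjection (freeGr (F.deg 0)) (quotGr (relevantIdeal k Δ)) ε) :
    F.IsVirtualResolution (faceIdeal k (facesOf Δ)) := by
  constructor
  · intro i
    -- The complex is exact in positive degrees, so the condition on annihilators holds with zero
    -- homology.
    have : Subsingleton (F.Hsucc i) := by
      refine Submodule.Quotient.subsingleton_iff.2 (Submodule.comap_subtype_eq_top.2 (hexact i))
    rw [Module.annihilator_eq_top_iff.2 this, Ideal.radical_top]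
    exact le_top
  have hle : relevantIdeal k Δ ≤ faceIdeal k (facesOf Δ) := relevantIdeal_eq.trans_le inf_le_left
  let I := faceIdeal k (facesOf Δ)
  let B := irrelevantIdeal k n
  let ψ : F.term 0 →ₗ[Cox k n] ((Cox k n ⧸ I) ⧸ torsionPart B (Cox k n ⧸ I)) :=
    (torsionPart B (Cox k n ⧸ I)).mkQ ∘ₗ Submodule.factor hle ∘ₗ ε
  have hψ : ∀ x f, ε x = Ideal.Quotient.mk _ f →
      ψ x = Submodule.Quotient.mk (Ideal.Quotient.mk I f) := fun x f h => by
    change Submodule.Quotient.mk (Submodule.factor hle (ε x)) = _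
    rw [h]
    rfl
  have hψd : LinearMap.range (F.d 0) ≤ LinearMap.ker ψ := fun x hx => by
    rw [← hker, LinearMap.mem_ker] at hx
    change Submodule.Quotient.mk (Submodule.factor hle (ε x)) = _
    rw [hx, map_zero, Submodule.Quotient.mk_zero]
  let φ : F.H₀ →ₗ[Cox k n] ((Cox k n ⧸ I) ⧸ torsionPart B (Cox k n ⧸ I)) :=
    (LinearMap.range (F.d 0)).liftQ ψ hψd
  have hφ : Function.Surjective φ := by
    intro y
    obtain ⟨z, rfl⟩ := Submodule.Quotient.mk_surjective _ y
    obtain ⟨f, rfl⟩ := Ideal.Quotient.mk_surjective z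
    obtain ⟨x, hx⟩ := hε.surjective (Ideal.Quotient.mk _ f)
    exact ⟨Submodule.Quotient.mk x, hψ x f hx⟩
  -- `H₀` is S/(I ∩ B), whose torsion is I/(I ∩ B), the kernel of the projection to S/I; the latter
  -- has no torsion.
  have hkerφ : torsionPart B F.H₀ = LinearMap.ker φ := by
    ext y
    obtain ⟨x, rfl⟩ := Submodule.Quotient.mk_surjective _ y
    obtain ⟨f, hf⟩ := Ideal.Quotient.mk_surjective (ε x)
    have h1 : Submodule.Quotient.mk x ∈ LinearMap.ker φ ↔ f ∈ I := by
      have h2 : φ (Submodule.Quotient.mk x) = Submodule.Quotient.mk (Ideal.Quotient.mk I f) :=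
        hψ x f hf.symm
      rw [LinearMap.mem_ker, h2, Submodule.Quotient.mk_eq_zero, torsionPart_faceIdeal hbal,
        Submodule.mem_bot]
      exact Ideal.Quotient.eq_zero_iff_mem
    rw [h1, ← mk_mem_torsionPart_relevantIdeal hbal, hf]
    refine exists_congr fun a => forall₂_congr fun b _ => ?_
    rw [← Submodule.Quotient.mk_smul, Submodule.Quotient.mk_eq_zero, ← hker, LinearMap.mem_ker,
      map_smul]
  refine ⟨(Submodule.quotEquivOfEq _ _ hkerφ).trans (φ.quotKerEquivOfSurjective hφ), fun δ => ?_⟩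
  have he : ∀ x : F.term 0, ((Submodule.quotEquivOfEq _ _ hkerφ).trans
      (φ.quotKerEquivOfSurjective hφ)) (Submodule.Quotient.mk (Submodule.Quotient.mk x)) = ψ x :=
    fun x => rfl
  ext z
  constructor
  · rintro ⟨_, ⟨x, hx, rfl⟩, rfl⟩
    obtain ⟨f, hf, hfx⟩ := hε.map_mem hx
    exact ⟨f, hf, (he x).trans (hψ x f hfx.symm)⟩
  · rintro ⟨f, hf, rfl⟩
    obtain ⟨x, hx, hxf⟩ := hε.exists_lift (y := Ideal.Quotient.mk _ f) ⟨f, hf, rfl⟩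
    exact ⟨_, ⟨x, hx, rfl⟩, (he x).trans (hψ x f hxf)⟩

end StanleyReisner

/-! ### The variety of a balanced complex -/

section Variety

variable {k : Type u} [Field k] {r : ℕ} {n : Fin r → ℕ}
  {Δ : PreAbstractSimplicialComplex (Vertex n)}

theorem faceIdeal_singleton_eq_span (σ : Finset (Vertex n)) :
    faceIdeal k {σ} = Ideal.span (X '' {v : Vertex n | v ∉ σ}) := by
  ext f
  rw [mem_ideal_span_X_image, mem_faceIdeal]
  simp only [MvPolynomial.mem_support_iff, Set.mem_singleton_iff, forall_eq, Finset.not_subset,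
    Finsupp.mem_support_iff]
  refine forall₂_congr fun m _ => exists_congr fun v => ?_
  exact and_comm

theorem X_mem_faceIdeal_singleton {σ : Finset (Vertex n)} {v : Vertex n} (hv : v ∉ σ) :
    (X v : Cox k n) ∈ faceIdeal k {σ} := by
  rw [faceIdeal_singleton_eq_span]
  exact Ideal.subset_span ⟨v, hv, rfl⟩

/-- It is the kernel of the endomorphism of the polynomial ring, a domain, that sends the variables
outside σ to zero and fixes the others. -/
theorem isPrime_faceIdeal_singleton (σ : Finset (Vertex n)) : (faceIdeal k {σ}).IsPrime := by
  let φ : Cox k n →ₐ[k] Cox k n := aeval fun v => if v ∈ σ then X v else 0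
  have h : faceIdeal k {σ} = RingHom.ker φ := by
    apply le_antisymm
    · rw [faceIdeal_singleton_eq_span, Ideal.span_le]
      rintro _ ⟨v, hv, rfl⟩
      change φ (X v) = 0
      rw [aeval_X, if_neg hv]
    · have hφ : (Ideal.Quotient.mkₐ k (faceIdeal k {σ})).comp φ =
          Ideal.Quotient.mkₐ k (faceIdeal k {σ}) := by
        refine MvPolynomial.algHom_ext fun v => ?_
        rw [AlgHom.comp_apply, aeval_X]
        split_ifs with hv
        · rfl
        · rw [map_zero, eq_comm]
          exact Ideal.Quotient.eq_zero_iff_mem.2 (X_mem_faceIdeal_singleton hv)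
      intro f hf
      have h1 := DFunLike.congr_fun hφ f
      rw [AlgHom.comp_apply, (RingHom.mem_ker).1 hf, map_zero] at h1
      exact Ideal.Quotient.eq_zero_iff_mem.1 h1.symm
  rw [h]
  exact RingHom.ker_isPrime _

theorem isHomogeneous_faceIdeal_singleton (σ : Finset (Vertex n)) :
    (faceIdeal k {σ}).IsHomogeneous (coxGrading k n) := by
  rw [faceIdeal_singleton_eq_span]
  refine Ideal.homogeneous_span _ _ ?_
  rintro _ ⟨v, -, rfl⟩
  exact ⟨_, isWeightedHomogeneous_X k (multideg n) v⟩

/-- The multidegree of a monomial supported on a transversal determines its exponents. -/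
theorem IsTransversal.weight_apply {σ : Finset (Vertex n)} (hσ : IsTransversal σ)
    {m : Vertex n →₀ ℕ} (hm : m.support ⊆ σ) {v : Vertex n} (hv : v ∈ σ) :
    Finsupp.weight (multideg n) m v.1 = m v := by
  rw [Finsupp.weight_apply, Finsupp.sum, Finset.sum_apply, Finset.sum_eq_single v]
  · simp [multideg]
  · intro w hw hwv
    have : v.1 ≠ w.1 := fun h => hwv (hσ.eq_of_fst_eq (hm hw) hv h.symm)
    simp [multideg, this]
  · intro h
    rw [Finsupp.notMem_support_iff.1 h]
    simp

theorem IsTransversal.eq_of_weight_eq {σ : Finset (Vertex n)} (hσ : IsTransversal σ)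
    {m m' : Vertex n →₀ ℕ} (hm : m.support ⊆ σ) (hm' : m'.support ⊆ σ)
    (h : Finsupp.weight (multideg n) m = Finsupp.weight (multideg n) m') : m = m' := by
  ext v
  by_cases hv : v ∈ σ
  · have h1 := hσ.weight_apply hm hv
    rw [h, hσ.weight_apply hm' hv] at h1
    exact_mod_cast h1.symm
  · rw [Finsupp.notMem_support_iff.1 fun h => hv (hm h),
      Finsupp.notMem_support_iff.1 fun h => hv (hm' h)]

/-- The points of the variety of a balanced complex correspond to the facets. -/
theorem exists_facet_of_mem_variety (hbal : IsBalanced Δ) {p : PrimeSpectrum (Cox k n)}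
    (hp : p ∈ variety n (faceIdeal k (facesOf Δ))) :
    ∃ σ, IsFacet Δ σ ∧ p.asIdeal = faceIdeal k {σ} := by
  obtain ⟨hhom, hB, hI⟩ := hp
  have hprime := p.2
  -- Otherwise each facet omits a vertex whose variable is not in p. The product of these variables
  -- is supported on a non-face, so it lies in I and hence in p, which is prime.
  have hcontains : ∃ σ, IsFacet Δ σ ∧ ∀ v ∉ σ, (X v : Cox k n) ∈ p.asIdeal := by
    by_contra! hcon
    choose w hwσ hwp using hcon
    have hfin : {σ | IsFacet Δ σ}.Finite := Set.toFinite _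
    let T := hfin.toFinset.attach.image fun σ => w σ.1 (hfin.mem_toFinset.1 σ.2)
    have hT : ∏ v ∈ T, (X v : Cox k n) ∈ p.asIdeal := by
      refine hI ((mem_faceIdeal_of_isLowerSet isLowerSet_facesOf).2 fun m hm => ?_)
      rw [← monomial_expo, coeff_monomial] at hm
      split_ifs at hm with h
      · subst h
        rw [support_expo]
        rintro ⟨σ, hσ, hTσ⟩
        exact hwσ σ hσ (hTσ (Finset.mem_image.2
          ⟨⟨σ, hfin.mem_toFinset.2 hσ⟩, Finset.mem_attach _ _, rfl⟩))
      · exact absurd rfl hm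
    obtain ⟨v, hv, hvp⟩ := (Ideal.IsPrime.prod_mem_iff).1 hT
    obtain ⟨σ, hσ, rfl⟩ := Finset.mem_image.1 hv
    exact hwp _ _ hvp
  obtain ⟨σ, hσ, hσp⟩ := hcontains
  have hle : faceIdeal k {σ} ≤ p.asIdeal := by
    rw [faceIdeal_singleton_eq_span, Ideal.span_le]
    rintro _ ⟨v, hv, rfl⟩
    exact hσp v hv
  -- The other variables in the component of v lie outside σ and so in p; with the variable of v the
  -- whole component would be in p, and p would contain B.
  have hσX : ∀ v ∈ σ, (X v : Cox k n) ∉ p.asIdeal := by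
    intro v hv hvp
    refine hB ((iInf_le _ v.1).trans (Ideal.span_le.2 ?_))
    rintro _ ⟨j, rfl⟩
    by_cases hj : (⟨v.1, j⟩ : Vertex n) ∈ σ
    · have := IsTransversal.eq_of_fst_eq (hbal σ hσ) hj hv rfl
      change X (⟨v.1, j⟩ : Vertex n) ∈ p.asIdeal
      rwa [this]
    · exact hσp _ hj
  refine ⟨σ, hσ, le_antisymm (fun f hf => ?_) hle⟩
  by_contra hfσ
  rw [mem_faceIdeal] at hfσ
  push Not at hfσ
  obtain ⟨m, hm, A, hA, hmσ⟩ := hfσ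
  rw [Set.mem_singleton_iff.1 hA] at hmσ
  -- Among monomials supported on σ, `m` is the only one of its multidegree. Modulo the variables
  -- outside σ this component of `f` is one monomial, which p would have to contain.
  have hcomp := weightedHomogeneousComponent_mem_of_mem k (multideg n) hhom hf
    (Finsupp.weight (multideg n) m)
  have hdiff : weightedHomogeneousComponent (multideg n) (Finsupp.weight (multideg n) m) f -
      monomial m (coeff m f) ∈ faceIdeal k {σ} := by
    refine mem_faceIdeal.2 fun m' hm' A hA hm'σ => ?_
    rw [Set.mem_singleton_iff.1 hA] at hm'σ
    rw [coeff_sub, coeff_weightedHomogeneousComponent, coeff_monomial] at hm'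
    by_cases hw : Finsupp.weight (multideg n) m' = Finsupp.weight (multideg n) m
    · have := IsTransversal.eq_of_weight_eq (hbal σ hσ) hm'σ hmσ hw
      subst this
      simp at hm'
    · have hne : m ≠ m' := fun h => hw (by rw [h])
      simp [hw, hne] at hm'
  have hmon : monomial m (coeff m f) ∈ p.asIdeal := by
    have := sub_mem hcomp (hle hdiff)
    rwa [sub_sub_cancel] at this
  rw [monomial_eq] at hmon
  rcases hprime.mem_or_mem hmon with h | h
  · refine hprime.ne_top (Ideal.eq_top_of_isUnit_mem _ h ?_)
    exact (isUnit_iff_ne_zero.2 hm).map C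
  · obtain ⟨v, hv, hvp⟩ := (Ideal.IsPrime.prod_mem_iff).1 h
    exact hσX v (hmσ hv) (hprime.mem_of_pow_mem _ hvp)

theorem mem_variety_of_isFacet (hbal : IsBalanced Δ) {σ : Finset (Vertex n)}
    (hσ : IsFacet Δ σ) : (⟨faceIdeal k {σ}, isPrime_faceIdeal_singleton σ⟩ :
      PrimeSpectrum (Cox k n)) ∈ variety n (faceIdeal k (facesOf Δ)) := by
  refine ⟨isHomogeneous_faceIdeal_singleton σ, fun hB => ?_, fun f hf => ?_⟩
  · have h := mem_faceIdeal.1 (hB (monomial_expo_mem_irrelevantIdeal (k := k) (hbal σ hσ)))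
      (expo σ) (by simp) σ rfl
    rw [support_expo] at h
    exact h subset_rfl
  · refine mem_faceIdeal.2 fun m hm A hA => ?_
    rw [Set.mem_singleton_iff.1 hA]
    exact mem_faceIdeal.1 hf m hm σ ⟨σ, hσ, subset_rfl⟩

theorem subset_of_faceIdeal_singleton_le {σ τ : Finset (Vertex n)}
    (h : faceIdeal k {σ} ≤ faceIdeal k {τ}) : τ ⊆ σ := by
  intro v hv
  by_contra hvσ
  refine mem_faceIdeal.1 (h (X_mem_faceIdeal_singleton hvσ)) (Finsupp.single v 1)
    (by simp) τ rfl ?_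
  exact Finsupp.support_single_subset.trans (Finset.singleton_subset_iff.2 hv)

/-- The points are finitely many and pairwise incomparable as primes, since distinct transversals
are; a finite T1 space is discrete. -/
theorem topologicalKrullDim_variety (hne : ∃ σ, σ ∈ Δ) (hbal : IsBalanced Δ) :
    topologicalKrullDim (variety n (faceIdeal k (facesOf Δ))) = 0 := by
  let Z := variety n (faceIdeal k (facesOf Δ))
  have hZ : ∀ p : Z, ∃ σ, IsFacet Δ σ ∧ p.1.asIdeal = faceIdeal k {σ} := fun p =>
    exists_facet_of_mem_variety hbal p.2
  choose s hs hsp using hZ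
  have hfinite : Finite Z := Finite.of_injective s fun p q hpq => by
    refine Subtype.ext (PrimeSpectrum.ext ?_)
    rw [hsp, hsp, hpq]
  have hT1 : T1Space Z := by
    refine ⟨fun p => ?_⟩
    have h : ({p} : Set Z) = Subtype.val ⁻¹' PrimeSpectrum.zeroLocus (p.1.asIdeal : Set _) := by
      ext q
      rw [Set.mem_singleton_iff, Set.mem_preimage, PrimeSpectrum.mem_zeroLocus,
        SetLike.coe_subset_coe]
      refine ⟨fun h => h ▸ le_rfl, fun h => ?_⟩
      rw [hsp, hsp] at h
      have h1 : s q = s p := IsTransversal.eq_of_subset (hbal _ (hs q))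
        (hbal _ (hs p)) (subset_of_faceIdeal_singleton_le h)
      refine Subtype.ext (PrimeSpectrum.ext ?_)
      rw [hsp, hsp, h1]
    rw [h]
    exact (PrimeSpectrum.isClosed_zeroLocus _).preimage continuous_subtype_val
  obtain ⟨σ, hσ⟩ := hne
  obtain ⟨τ, hτ, -⟩ := exists_isFacet_of_mem hσ
  let z : Z := ⟨_, mem_variety_of_isFacet hbal hτ⟩
  -- Non-emptiness excludes the dimension ⊥ and is where the existence of a face enters.
  have hI : Nonempty (TopologicalSpace.IrreducibleCloseds Z) :=
    ⟨⟨{z}, isIrreducible_singleton, isClosed_singleton⟩⟩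
  exact le_antisymm (topologicalKrullDim_zero_of_discreteTopology Z) Order.krullDim_nonneg

end Variety

end VirtualCM

end

theorem theorem1p1 {k : Type*} [Field k] {r : ℕ} (n : Fin r → ℕ)
    (Δ : PreAbstractSimplicialComplex (VirtualCM.Vertex n))
    (hne : ∃ σ : Finset (VirtualCM.Vertex n), σ ∈ Δ)
    (hpure : VirtualCM.IsPure Δ) (hbal : VirtualCM.IsBalanced Δ) :
    VirtualCM.IsVirtuallyCohenMacaulay k Δ := by
  -- The codimension is |n|, the variety being of dimension zero.
  refine ⟨VirtualCM.isBSaturated hne hbal, ∑ i, n i, ?_⟩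
  obtain ⟨F, ε, hlen, hexact, hker, hε⟩ := (VirtualCM.hasRes_relevantIdeal (k := k) hne
    hbal).exists_complex (VirtualCM.nontrivial_quotient_relevantIdeal hne)
  rw [VirtualCM.stanleyReisnerIdeal_eq hne]
  refine ⟨F, ?_, hlen, VirtualCM.isVirtualResolution_of_resolves hbal F ε hexact hker hε⟩
  rw [VirtualCM.IsCodim, VirtualCM.topologicalKrullDim_variety hne hbal, add_zero]
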